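/- **Colors and crossings.** All arrows below are segments in the plane $\mathbb{R}^2$ with an orientation and a color, red or green. Given a set of tiles whose sides (and interior lines, if any) are arrows, the *crossing* at a point $v$ is the set of all these arrows that enter or leave $v$. - A crossing at $v$ is of type $C_4$ if it consists of exactly four arrows: two arrows of the same color, one entering and one leaving $v$ in the same direction (the *axis* of the crossing), and two arrows of different colors, perpendicular to the axis, that enter $v$ from opposite sides. - It is of type $C_8$ if it consists of exactly eight arrows: four as above and four more leaving $v$ at $45^\circ$ to the axis, such that, for each of the two arrows entering $v$ perpendicularly to the axis, and seen in the direction of that arrow, the leaving arrow adjacent to it on its left is red and the leaving arrow adjacent to it on its right is green. **Triangles.** The tiles are congruent isosceles right triangles, with legs parallel to two fixed perpendicular directions (so a tile is determined up to translation by rotations by multiples of $90^\circ$). Each triangle is colored red or green, and each of its sides has an orientation and a color (red or green), all chosen arbitrarily. A *correct tiling of the plane by triangles* is a set of such tiles with pairwise disjoint interiors that covers the plane, such that 1. tiles are attached side-to-side, and shared sides have matching colors and orientations; 2. any two triangles with a common side have different colors; 3. the crossing at every vertex is of type $C_4$ or $C_8$; 4. for each arrow of a $C_4$ crossing that enters its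 center perpendicularly to the axis, the triangle having this arrow as a side on its left is red and the one on its right is green. **Squares.** The tiles are congruent squares with parallel sides. Each side has an arbitrary orientation and an arbitrary color. The diagonals are drawn as four slanted arrows forming a $C_4$ crossing at the center of the square: the axis may have any of the four diagonal directions and either color, and either of the two perpendicular entering arrows may be the green one. The diagonals cut the square into four triangles, colored so that for each of the two slanted arrows perpendicular to the axis, the triangle adjacent to it on its left is red and the one on its right is green. A *correct tiling of the plane by square tiles* is a set of such tiles with pairwise disjoint interiors that covers the plane, such that tiles are attached side-to-side, shared sides have matching colors and orientations, triangles of different tiles with a common side have different colors, and the crossing at every corner (formed by sides and slanted arrows) is of type $C_8$. **Theorem.** Every correct tiling $T$ of the plane by triangles is non-periodic, that is, $T + a \neq T$ for every vector $a \neq 0$. Consequently, every correct tiling of the plane by square tiles is also non-periodic. -/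

import Mathlib

/-- The two colors used for triangles and for sides. -/
inductive TileColor where
  | red : TileColor
  | green : TileColor

/-- The opposite color. -/
def TileColor.other : TileColor → TileColor
  | .red => .green
  | .green => .red

/-- A colored arrow in the plane `ℂ`. -/
structure Arrow where
  src : ℂ
  tgt : ℂ
  color : TileColor

/-! ### Tilings in general -/

/-- A tiling of the whole plane: interiors of different tiles are disjoint and the tiles cover
the plane. -/
def IsPlaneTiling {α : Type} (region : α → Set ℂ) (T : Set α) : Prop :=
  T.Pairwise (fun t t' => Disjoint (interior (region t)) (interior (region t'))) ∧
    (⋃ t ∈ T, region t) = Set.univ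

/-- Tiles are attached side-to-side: any two different tiles meet in the convex hull of their
common vertices, that is, in nothing, in a common vertex, or in a whole common side. -/
def IsSideToSide {α : Type} (vertices : α → Set ℂ) (T : Set α) : Prop :=
  T.Pairwise (fun t t' => convexHull ℝ (vertices t) ∩ convexHull ℝ (vertices t') =
    convexHull ℝ (vertices t ∩ vertices t'))

/-- Two arrows lie on the same segment (possibly with different orientations and colors). -/
def Arrow.SameSegment (a b : Arrow) : Prop :=
  ({a.src, a.tgt} : Set ℂ) = {b.src, b.tgt}

/-! ### Crossings -/

/-- The set `X` of arrows is a crossing of type `C₄` with center `v` whose axis has direction `d`: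
a pair of arrows of one color passes through `v` in direction `d`, two arrows of different colors
perpendicular to the axis enter `v`, and there are no other arrows. -/
def IsCrossingC4 (X : Set Arrow) (v d : ℂ) : Prop :=
  d ≠ 0 ∧ ∃ (c e : TileColor) (r : Fin 4 → ℝ), (∀ k, 0 < r k) ∧
    X = {⟨v - r 0 * d, v, c⟩, ⟨v, v + r 1 * d, c⟩,
         ⟨v + r 2 * (Complex.I * d), v, e⟩, ⟨v - r 3 * (Complex.I * d), v, e.other⟩}

/-- The set `X` of arrows is a crossing of type `C₈` with center `v` whose axis has direction `d`:
a pair of arrows of one color passes through `v` in direction `d`, two arrows of different colors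
perpendicular to the axis enter `v`, and four arrows leave `v` at `45°` to the axis. Seen in the
direction of motion of an arrow that enters `v` perpendicularly to the axis, the leaving arrow
next to it on its left is red and the one next to it on its right is green. -/
def IsCrossingC8 (X : Set Arrow) (v d : ℂ) : Prop :=
  d ≠ 0 ∧ ∃ (c e : TileColor) (r : Fin 8 → ℝ), (∀ k, 0 < r k) ∧
    X = {⟨v - r 0 * d, v, c⟩, ⟨v, v + r 1 * d, c⟩,
         ⟨v + r 2 * (Complex.I * d), v, e⟩, ⟨v - r 3 * (Complex.I * d), v, e.other⟩,
         ⟨v, v + r 4 * ((1 + Complex.I) * d), .red⟩,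
         ⟨v, v - r 5 * ((1 + Complex.I) * d), .red⟩,
         ⟨v, v + r 6 * ((Complex.I - 1) * d), .green⟩,
         ⟨v, v - r 7 * ((Complex.I - 1) * d), .green⟩}

/-! ### Triangular tiles

The size and the position up to multiples of `90°` are given by a nonzero `s : ℂ`: the legs of
the tiles have length `‖s‖` and are parallel to `s` and `i * s`. -/

/-- A placed triangular tile: the vertex of the right angle, the rotation by a multiple of `90°`,
the color of the triangle, and the color and orientation of each of the three sides. -/
structure TriTile where
  apex : ℂ
  rot : Fin 4
  color : TileColor
  sideColor : Fin 3 → TileColor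
  /-- `ccw j` says that side `j` is oriented counterclockwise, so that the tile is to the left
  of the arrow. -/
  ccw : Fin 3 → Bool

namespace TriTile

/-- The vertices in counterclockwise order, starting from the right angle. -/
noncomputable def vertex (s : ℂ) (t : TriTile) : Fin 3 → ℂ :=
  ![t.apex, t.apex + s * Complex.I ^ (t.rot : ℕ), t.apex + s * Complex.I ^ ((t.rot : ℕ) + 1)]

/-- The set of vertices. -/
def vertices (s : ℂ) (t : TriTile) : Set ℂ := Set.range (t.vertex s)

/-- The closed triangle. -/
def region (s : ℂ) (t : TriTile) : Set ℂ := convexHull ℝ (t.vertices s)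

/-- Side `j` joins vertex `j` to vertex `j + 1` (cyclically); side `1` is the hypotenuse. -/
noncomputable def arrow (s : ℂ) (t : TriTile) (j : Fin 3) : Arrow :=
  if t.ccw j then ⟨t.vertex s j, t.vertex s (j + 1), t.sideColor j⟩
  else ⟨t.vertex s (j + 1), t.vertex s j, t.sideColor j⟩

/-- The tile shifted by `a`. -/
noncomputable def translate (a : ℂ) (t : TriTile) : TriTile := { t with apex := t.apex + a }

/-- The crossing of `T` at `v`: all arrows that enter or leave `v`. -/
def crossing (s : ℂ) (T : Set TriTile) (v : ℂ) : Set Arrow :=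
  {a | (∃ t ∈ T, ∃ j, a = t.arrow s j) ∧ (a.src = v ∨ a.tgt = v)}

end TriTile

/-- A correct tiling of the plane by triangles. -/
structure IsCorrectTriTiling (s : ℂ) (T : Set TriTile) : Prop where
  tiling : IsPlaneTiling (TriTile.region s) T
  side_to_side : IsSideToSide (TriTile.vertices s) T
  /-- Shared sides have matching colors and orientations. -/
  sides_match : ∀ t ∈ T, ∀ t' ∈ T, ∀ j j',
    (t.arrow s j).SameSegment (t'.arrow s j') → t.arrow s j = t'.arrow s j'
  /-- Different triangles with a common side have different colors. -/
  colors_differ : ∀ t ∈ T, ∀ t' ∈ T, t ≠ t' → ∀ j j',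
    (t.arrow s j).SameSegment (t'.arrow s j') → t.color ≠ t'.color
  /-- All crossings are `C₄` or `C₈`. -/
  crossings : ∀ t ∈ T, ∀ v ∈ t.vertices s,
    ∃ d, IsCrossingC4 (TriTile.crossing s T v) v d ∨ IsCrossingC8 (TriTile.crossing s T v) v d
  /-- If one goes to the center of a `C₄` crossing perpendicularly to the axis, then there is a
  red triangle on the left and a green triangle on the right. -/
  left_right : ∀ v d, IsCrossingC4 (TriTile.crossing s T v) v d →
    ∀ t ∈ T, ∀ j, (t.arrow s j).tgt = v →
      (∃ r : ℝ, (t.arrow s j).src - v = r * (Complex.I * d)) →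
      t.color = if t.ccw j then TileColor.red else TileColor.green

/-! ### Square tiles

The diagonals of the tiles have length `2 * ‖s‖` and are parallel to `s` and `i * s`. -/

/-- A placed square tile. It has four arbitrarily colored and oriented sides, and its diagonals are
drawn as four slanted arrows: two of color `axisColor` that pass through the center towards
corner `axis`, and two that enter the center from the two other corners, one of color `leftColor`
from the corner on the left of the axis, one of the opposite color from the corner on the right. -/
structure SquareTile where
  center : ℂ
  axis : Fin 4
  axisColor : TileColor
  leftColor : TileColor
  sideColor : Fin 4 → TileColor
  /-- `ccw j` says that side `j` is oriented counterclockwise. -/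
  ccw : Fin 4 → Bool

namespace SquareTile

/-- The corners in counterclockwise order. -/
noncomputable def corner (s : ℂ) (t : SquareTile) (j : Fin 4) : ℂ :=
  t.center + s * Complex.I ^ (j : ℕ)

/-- The set of corners. -/
def corners (s : ℂ) (t : SquareTile) : Set ℂ := Set.range (t.corner s)

/-- The closed square. -/
def region (s : ℂ) (t : SquareTile) : Set ℂ := convexHull ℝ (t.corners s)

/-- Side `j` joins corner `j` to corner `j + 1` (cyclically). -/
noncomputable def sideArrow (s : ℂ) (t : SquareTile) (j : Fin 4) : Arrow :=
  if t.ccw j then ⟨t.corner s j, t.corner s (j + 1), t.sideColor j⟩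
  else ⟨t.corner s (j + 1), t.corner s j, t.sideColor j⟩

/-- The four slanted arrows. -/
def slantedArrows (s : ℂ) (t : SquareTile) : Set Arrow :=
  {⟨t.corner s (t.axis + 2), t.center, t.axisColor⟩,
   ⟨t.center, t.corner s t.axis, t.axisColor⟩,
   ⟨t.corner s (t.axis + 1), t.center, t.leftColor⟩,
   ⟨t.corner s (t.axis + 3), t.center, t.leftColor.other⟩}

/-- The color of the triangle cut off by the diagonals at side `j`: for each of the two slanted
arrows perpendicular to the axis, the triangle on its left is red, that on its right is green. -/
def triColor (t : SquareTile) (j : Fin 4) : TileColor :=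
  if j = t.axis ∨ j = t.axis + 2 then TileColor.red else TileColor.green

/-- The tile shifted by `a`. -/
noncomputable def translate (a : ℂ) (t : SquareTile) : SquareTile :=
  { t with center := t.center + a }

/-- The crossing of `T` at `v`: all arrows (sides and slanted) that enter or leave `v`. -/
def crossing (s : ℂ) (T : Set SquareTile) (v : ℂ) : Set Arrow :=
  {a | (∃ t ∈ T, (∃ j, a = t.sideArrow s j) ∨ a ∈ t.slantedArrows s) ∧ (a.src = v ∨ a.tgt = v)}

end SquareTile

/-- A correct tiling of the plane by square tiles. -/
structure IsCorrectSquareTiling (s : ℂ) (T : Set SquareTile) : Prop where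
  tiling : IsPlaneTiling (SquareTile.region s) T
  side_to_side : IsSideToSide (SquareTile.corners s) T
  /-- Shared sides have matching colors and orientations. -/
  sides_match : ∀ t ∈ T, ∀ t' ∈ T, ∀ j j',
    (t.sideArrow s j).SameSegment (t'.sideArrow s j') → t.sideArrow s j = t'.sideArrow s j'
  /-- Triangles of different tiles that share a side have different colors. (The four triangles
  inside one tile alternate in color.) -/
  colors_differ : ∀ t ∈ T, ∀ t' ∈ T, t ≠ t' → ∀ j j',
    (t.sideArrow s j).SameSegment (t'.sideArrow s j') → t.triColor j ≠ t'.triColor j'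
  /-- All crossings at corners are `C₈`. -/
  crossings : ∀ t ∈ T, ∀ v ∈ t.corners s, ∃ d, IsCrossingC8 (SquareTile.crossing s T v) v d

/-!
# Non-periodicity of tilings with two colors of arrows

**The lattice.** At the right angle of a triangle, the crossing cannot be of type `C₈`: one of its
arrows would be a side that enters the interior of the triangle. So four triangles meet there with
their right angles and form a square (`IsCorrectTriTiling.exists_rotated`), the squares form a
square grid (`IsCorrectTriTiling.exists_apex`, `IsCorrectTriTiling.apex_mem_lattice`), with
crossings of type `C₄` at the centers of the squares and of type `C₈` at their corners. So a tiling
by triangles carries the same data as a tiling by square tiles. In units of half a diagonal, the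
centers are the Gaussian integers with even coordinate sum, the corners those with odd sum. A
triangle is red or green according to the position of its square's axis, so that different colors
across a side mean that neighboring squares have perpendicular axes. `IsCorrectLattice`
keeps the crossings and, of the colors of the triangles, only this.

**The coarser tiling.** Since neighboring axes are perpendicular, each corner `v` is either
tangential (the axes of all four squares at `v` are perpendicular to the line to `v`) or radial (they
all pass through `v`), and the two kinds alternate along the grid. Erase in each square the two
arrows perpendicular to its axis, and join the two arrows of its axis. At a radial corner nothing is
erased and the crossing remains of type `C₈`. At a tangential corner four arrows are erased, all of
which leave `v`; as three of the four arrows along and across the axis of a `C₈` crossing enter it,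
the erased arrows are those at `45°` to the axis, and a `C₄` crossing remains. Finally, the two
perpendicular arrows in a square have different colors and the colors of the arrows at `45°` to the
axis of a `C₈` crossing are prescribed; hence new neighboring axes are perpendicular again. So a
correct tiling by squares with sides longer by the factor `√2` arises (`IsCorrectLattice.coarsen`).

**Descent.** A period of the tiling is a period of the coarser one. In the coarser lattice
coordinates it is divided by `1 + i`, and it still maps centers to centers, so a nonzero period
could be divided by `1 + i` forever (`IsCorrectLattice.not_periodic`).
-/

/-! ### Crossings in lattice coordinates -/

instance : DecidableEq TileColor := fun a b => by
  cases a <;> cases b <;> first | exact isTrue rfl | exact isFalse (by simp)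

instance : Fintype TileColor := ⟨{.red, .green}, fun c => by cases c <;> simp⟩

/-- The eight displacements to neighbouring lattice points, counterclockwise; even directions
are unit steps, odd directions are diagonal steps. -/
def step (δ : ZMod 8) : GaussianInt :=
  (![⟨1, 0⟩, ⟨1, 1⟩, ⟨0, 1⟩, ⟨-1, 1⟩, ⟨-1, 0⟩, ⟨-1, -1⟩, ⟨0, -1⟩, ⟨1, -1⟩] :
    Fin 8 → GaussianInt) δ

/-- The free parameters of a crossing: the direction of its axis (numbered as in `step`), the color
of the axis, and the color of the arrow that enters from the left of the axis. -/
structure Crossing where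
  axis : ZMod 8
  axisColor : TileColor
  leftColor : TileColor

/-- What is seen at a vertex in one direction: possibly an arrow, with its color and with `true`
if it leaves the vertex. -/
abbrev Ray := Option (Bool × TileColor)

/-- The same arrow seen from its other end. -/
def Ray.flip : Ray → Ray := Option.map fun x => (!x.1, x.2)

/-- The rays of a `C₈` crossing. -/
def Crossing.ray8 (σ : Crossing) (δ : ZMod 8) : Ray :=
  (![some (true, σ.axisColor), some (true, .red), some (false, σ.leftColor), some (true, .green),
    some (false, σ.axisColor), some (true, .red), some (false, σ.leftColor.other),
    some (true, .green)] : Fin 8 → Ray) (δ - σ.axis)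

/-- Lattice points with even coordinate sum: the centers of the squares. The other lattice points
are the corners of the squares. -/
def IsCenter (p : GaussianInt) : Prop := Even (p.re + p.im)

instance : DecidablePred IsCenter := fun p => inferInstanceAs (Decidable (Even (p.re + p.im)))

/-- Even directions are parallel to the unit steps. -/
def IsStraight (δ : ZMod 8) : Prop := δ ∈ ({0, 2, 4, 6} : Finset (ZMod 8))

instance : DecidablePred IsStraight := fun δ =>
  inferInstanceAs (Decidable (δ ∈ ({0, 2, 4, 6} : Finset (ZMod 8))))

/-- The rays of a `C₄` crossing: the rays of a `C₈` crossing parallel and perpendicular to the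
axis. -/
def Crossing.ray4 (σ : Crossing) (δ : ZMod 8) : Ray :=
  if IsStraight (δ - σ.axis) then σ.ray8 δ else none

lemma Crossing.ray4_eq_ray8 (τ : Crossing) {δ : ZMod 8} (h : IsStraight (δ - τ.axis)) :
    τ.ray4 δ = τ.ray8 δ := if_pos h

lemma Crossing.ray4_eq_none (τ : Crossing) {δ : ZMod 8} (h : ¬ IsStraight (δ - τ.axis)) :
    τ.ray4 δ = none := if_neg h

lemma Crossing.ray8_of_sub_eq (a e : TileColor) {k δ ε : ZMod 8} (h : δ - k = ε) :
    (⟨k, a, e⟩ : Crossing).ray8 δ = (⟨0, a, e⟩ : Crossing).ray8 ε := by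
  simp only [ray8, h, sub_zero]

lemma Crossing.ray4_of_sub_eq (a e : TileColor) {k δ ε : ZMod 8} (h : δ - k = ε) :
    (⟨k, a, e⟩ : Crossing).ray4 δ = (⟨0, a, e⟩ : Crossing).ray4 ε := by
  simp only [ray4, ray8_of_sub_eq a e h, h, sub_zero]

/-- The rays at `p` of a lattice of crossings. -/
def rays (σ : GaussianInt → Crossing) (p : GaussianInt) (δ : ZMod 8) : Ray :=
  if IsCenter p then (σ p).ray4 δ else (σ p).ray8 δ

lemma rays_of_center {σ : GaussianInt → Crossing} {p : GaussianInt} (h : IsCenter p)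
    (δ : ZMod 8) : rays σ p δ = (σ p).ray4 δ := if_pos h

lemma rays_of_corner {σ : GaussianInt → Crossing} {p : GaussianInt} (h : ¬ IsCenter p)
    (δ : ZMod 8) : rays σ p δ = (σ p).ray8 δ := if_neg h

/-- A correct tiling by squares, in lattice coordinates: `C₄` crossings at the centers and `C₈`
crossings at the corners that fit together, such that the axes of squares with a common side are
perpendicular. -/
structure IsCorrectLattice (σ : GaussianInt → Crossing) : Prop where
  straight : ∀ p, IsCenter p → IsStraight (σ p).axis
  /-- The two ends of each arrow agree. -/
  fit : ∀ p δ, rays σ (p + step δ) (δ + 4) = (rays σ p δ).flip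
  /-- Diagonal steps from a center lead to the neighboring centers. -/
  perp : ∀ p, IsCenter p → ∀ δ, ¬ IsStraight δ →
    (σ (p + step δ)).axis = (σ p).axis + 2 ∨ (σ (p + step δ)).axis = (σ p).axis + 6

lemma isCenter_add_step (p : GaussianInt) (δ : ZMod 8) :
    IsCenter (p + step δ) ↔ (IsCenter p ↔ ¬ IsStraight δ) := by
  have h : ∀ δ, (Even ((step δ).re + (step δ).im) ↔ ¬ IsStraight δ) := by decide
  rw [← h δ]
  simp only [IsCenter, Zsqrtd.re_add, Zsqrtd.im_add, Int.even_add]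
  tauto

lemma step_add_four (δ : ZMod 8) : step (δ + 4) = - step δ := by
  revert δ; decide

/-- `1 + i`. -/
abbrev oneAddI : GaussianInt := ⟨1, 1⟩

lemma oneAddI_mul_step {δ : ZMod 8} (h : IsStraight δ) : oneAddI * step δ = step (δ + 1) := by
  revert δ; decide

lemma oneAddI_mul_step' {δ : ZMod 8} (h : ¬ IsStraight δ) :
    oneAddI * step δ = step (δ + 1) + step (δ + 1) := by
  revert δ; decide

/-- Points of even coordinate sum are the multiples of `1 + i`. -/
lemma IsCenter.exists_eq_mul {p : GaussianInt} (h : IsCenter p) : ∃ q, p = oneAddI * q := by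
  obtain ⟨m, hm⟩ := h
  refine ⟨⟨m, m - p.re⟩, ?_⟩
  ext <;> simp [oneAddI]; linarith

/-- Unit steps lead everywhere. -/
@[elab_as_elim]
lemma GaussianInt.induction_step {P : GaussianInt → Prop} (zero : P 0)
    (step : ∀ q δ, IsStraight δ → P q → P (q + step δ)) (q : GaussianInt) : P q := by
  obtain ⟨x, y⟩ := q
  have h0 : ∀ x : ℤ, P ⟨x, 0⟩ := by
    intro x
    induction x with
    | zero => exact zero
    | succ n ih => exact step ⟨n, 0⟩ 0 (by decide) ih
    | pred n ih => exact step ⟨-n, 0⟩ 4 (by decide) ih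
  induction y with
  | zero => exact h0 x
  | succ n ih =>
    have := step ⟨x, n⟩ 2 (by decide) ih
    rwa [show (⟨x, n⟩ + _root_.step 2 : GaussianInt) = ⟨x, n + 1⟩ by
      ext <;> simp [_root_.step]] at this
  | pred n ih =>
    have := step ⟨x, -n⟩ 6 (by decide) ih
    rwa [show (⟨x, -n⟩ + _root_.step 6 : GaussianInt) = ⟨x, -n - 1⟩ by
      ext <;> simp [_root_.step, sub_eq_add_neg]] at this

/-! ### The coarser tiling -/

/-- At a corner `v` the axes of the four surrounding squares are all perpendicular to the line to
`v` or all parallel to it; in the first case, `v` is called tangential. -/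
def IsTangential (σ : GaussianInt → Crossing) (v : GaussianInt) : Prop :=
  (σ (v + step 0)).axis = 2 ∨ (σ (v + step 0)).axis = 6

namespace IsCorrectLattice

variable {σ : GaussianInt → Crossing}

/-- The axes of consecutive squares around a corner are perpendicular. -/
lemma axis_quarter (h : IsCorrectLattice σ) {v : GaussianInt} (hv : ¬ IsCenter v) {δ : ZMod 8}
    (hδ : IsStraight δ) :
    (σ (v + step (δ + 2))).axis = (σ (v + step δ)).axis + 2 ∨
    (σ (v + step (δ + 2))).axis = (σ (v + step δ)).axis + 6 := by
  have e : ∀ δ, IsStraight δ → step (δ + 2) = step δ + step (δ + 3) ∧ ¬ IsStraight (δ + 3) := by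
    decide
  rw [(e δ hδ).1, ← add_assoc]
  refine h.perp _ ?_ _ (e δ hδ).2
  rw [isCenter_add_step]; tauto

/-- Tangentiality can be read off from any of the four squares at `v`. -/
lemma isTangential_iff (h : IsCorrectLattice σ) {v : GaussianInt} (hv : ¬ IsCenter v) {δ : ZMod 8}
    (hδ : IsStraight δ) : IsTangential σ v ↔
      (σ (v + step δ)).axis = δ + 2 ∨ (σ (v + step δ)).axis = δ + 6 := by
  have key : ∀ δ, IsStraight δ →
      (((σ (v + step δ)).axis = δ + 2 ∨ (σ (v + step δ)).axis = δ + 6) ↔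
       ((σ (v + step (δ + 2))).axis = δ + 2 + 2 ∨ (σ (v + step (δ + 2))).axis = δ + 2 + 6)) := by
    intro δ hδ
    have h1 := h.axis_quarter hv hδ
    have h2 : IsStraight (σ (v + step δ)).axis := h.straight _ (by
      rw [isCenter_add_step]; tauto)
    generalize (σ (v + step δ)).axis = x at *
    generalize (σ (v + step (δ + 2))).axis = y at *
    clear hv h v
    revert δ x y
    decide
  have k0 := key 0 (by decide)
  have k2 := key 2 (by decide)
  have k4 := key 4 (by decide)
  simp only [show (0 : ZMod 8) + 2 = 2 by decide, show (0 : ZMod 8) + 6 = 6 by decide,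
    show (2 : ZMod 8) + 2 = 4 by decide, show (4 : ZMod 8) + 2 = 6 by decide,
    show (2 : ZMod 8) + 6 = 0 by decide, show (4 : ZMod 8) + 6 = 2 by decide,
    show (6 : ZMod 8) + 2 = 0 by decide, show (6 : ZMod 8) + 6 = 4 by decide] at k0 k2 k4
  have hc : δ = 0 ∨ δ = 2 ∨ δ = 4 ∨ δ = 6 := by revert δ; decide
  rcases hc with rfl | rfl | rfl | rfl
  · rfl
  · exact k0
  · exact k0.trans k2
  · exact k0.trans (k2.trans k4)

/-- Of the two ends of a side of a square, exactly one is tangential: seen from the center of the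
square, they lie in perpendicular directions. -/
lemma isTangential_add_step (h : IsCorrectLattice σ) {v : GaussianInt} (hv : ¬ IsCenter v)
    {δ : ZMod 8} (hδ : ¬ IsStraight δ) : IsTangential σ (v + step δ) ↔ ¬ IsTangential σ v := by
  have e : ∀ δ, ¬ IsStraight δ →
      step δ + step (δ + 3) = step (δ + 1) ∧ IsStraight (δ + 3) ∧ IsStraight (δ + 1) := by decide
  obtain ⟨e1, e2, e3⟩ := e δ hδ
  have hv' : ¬ IsCenter (v + step δ) := by rw [isCenter_add_step]; tauto
  rw [h.isTangential_iff hv' e2, h.isTangential_iff hv e3, add_assoc, e1]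
  have h2 : IsStraight (σ (v + step (δ + 1))).axis := h.straight _ (by
    rw [isCenter_add_step]; tauto)
  generalize (σ (v + step (δ + 1))).axis = x at *
  clear hv hv' e1 e2 e3 h v
  revert δ x
  decide

lemma exists_isTangential (h : IsCorrectLattice σ) : ∃ v, ¬ IsCenter v ∧ IsTangential σ v := by
  by_cases h0 : IsTangential σ 1
  · exact ⟨1, by decide, h0⟩
  · exact ⟨1 + step 1, by decide,
      (h.isTangential_add_step (v := 1) (δ := 1) (by decide) (by decide)).2 h0⟩

lemma not_isCenter_lift {o : GaussianInt} (ho : ¬ IsCenter o) (q : GaussianInt) :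
    ¬ IsCenter (o + oneAddI * q) := by
  have : (o + oneAddI * q).re + (o + oneAddI * q).im = o.re + o.im + (q.re + q.re) := by
    simp [oneAddI]; ring
  unfold IsCenter at *
  rw [this, Int.even_add]
  simp [ho]

/-- The tangential corners form a sublattice of index two in the lattice of all corners. -/
lemma isTangential_lift (h : IsCorrectLattice σ) {o : GaussianInt} (ho : ¬ IsCenter o)
    (ht : IsTangential σ o) (q : GaussianInt) :
    IsTangential σ (o + oneAddI * q) ↔ IsCenter q := by
  have flip : ∀ q δ, IsStraight δ → (IsTangential σ (o + oneAddI * (q + step δ)) ↔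
      ¬ IsTangential σ (o + oneAddI * q)) := by
    intro q δ hδ
    have : ∀ δ, IsStraight δ → ¬ IsStraight (δ + 1) := by decide
    rw [mul_add, oneAddI_mul_step hδ, ← add_assoc]
    exact h.isTangential_add_step (not_isCenter_lift ho q) (this δ hδ)
  induction q using GaussianInt.induction_step with
  | zero => simp [ht, IsCenter]
  | step q δ hδ ih =>
    rw [flip q δ hδ, isCenter_add_step, show IsTangential σ (o + oneAddI * q) ↔ IsCenter q from ih]
    tauto

/-- At a tangential corner all unit arrows leave the corner, so the axis is diagonal. -/
lemma not_isStraight_axis (h : IsCorrectLattice σ) {v : GaussianInt} (hv : ¬ IsCenter v)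
    (ht : IsTangential σ v) : ¬ IsStraight (σ v).axis := by
  intro hk
  -- on a straight axis, an arrow would enter `v` from the center of the square behind `v`
  have hk4 : IsStraight ((σ v).axis + 4) := by
    generalize (σ v).axis = x at *; revert x; decide
  have h1 := (h.isTangential_iff hv hk4).1 ht
  have h2 := h.fit v ((σ v).axis + 4)
  have hc : IsCenter (v + step ((σ v).axis + 4)) := by rw [isCenter_add_step]; tauto
  rw [rays, rays, if_neg hv, if_pos hc] at h2
  generalize σ (v + step ((σ v).axis + 4)) = τ at *
  generalize σ v = ρ at *
  obtain ⟨k, a, e⟩ := τ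
  obtain ⟨k', a', e'⟩ := ρ
  clear hv ht h hc hk hk4
  simp only at h1 h2
  have h3 : k' + 4 + 4 - k = 2 ∨ k' + 4 + 4 - k = 6 := by
    clear h2; revert k k'; decide
  rw [Crossing.ray8_of_sub_eq a' e' (ε := 4) (by ring)] at h2
  clear h1
  rcases h3 with h3 | h3 <;> rw [Crossing.ray4_of_sub_eq a e h3] at h2 <;> clear h3 <;>
    revert a e a' e' <;> decide

end IsCorrectLattice

/-- The crossings of the coarser tiling, in the lattice coordinates in which a point `q` of the
coarser lattice is the point `o + (1 + i) q` of the finer one. All directions are turned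
by `45°`. -/
def coarsen (σ : GaussianInt → Crossing) (o q : GaussianInt) : Crossing :=
  { σ (o + oneAddI * q) with axis := (σ (o + oneAddI * q)).axis - 1 }

lemma Crossing.ray8_turn (τ : Crossing) (δ : ZMod 8) :
    Crossing.ray8 { τ with axis := τ.axis - 1 } δ = τ.ray8 (δ + 1) := by
  simp only [Crossing.ray8]
  rw [show δ - (τ.axis - 1) = δ + 1 - τ.axis by ring]

lemma isStraight_add_one (δ : ZMod 8) : IsStraight (δ + 1) ↔ ¬ IsStraight δ := by
  revert δ; decide

lemma isStraight_add_four (δ : ZMod 8) : IsStraight (δ + 4) ↔ IsStraight δ := by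
  revert δ; decide

lemma isStraight_sub (δ ε : ZMod 8) : IsStraight (δ - ε) ↔ (IsStraight δ ↔ IsStraight ε) := by
  revert δ ε; decide

/-- A direction of a `C₄` crossing parallel to its axis shows the same arrow as the opposite
direction, up to reversal. -/
lemma Crossing.ray4_add_four (τ : Crossing) {δ : ZMod 8} (h : δ = τ.axis ∨ δ = τ.axis + 4) :
    τ.ray4 (δ + 4) = (τ.ray4 δ).flip := by
  obtain ⟨k, a, e⟩ := τ
  rcases h with rfl | rfl
  · rw [ray4_of_sub_eq a e (δ := δ + 4) (ε := 4) (by ring),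
      ray4_of_sub_eq a e (δ := δ) (ε := 0) (by ring)]
    revert a e; decide
  · rw [ray4_of_sub_eq a e (δ := k + 4 + 4) (ε := 0) (by ring_nf; rfl),
      ray4_of_sub_eq a e (δ := k + 4) (ε := 4) (by ring)]
    revert a e; decide

/-- The two arrows of a `C₄` crossing perpendicular to its axis enter it and have different
colors. -/
lemma Crossing.ray4_perp (τ : Crossing) {δ : ZMod 8} (h : τ.axis = δ + 2 ∨ τ.axis = δ + 6) :
    ∃ c, τ.ray4 (δ + 4) = some (false, c) ∧ τ.ray4 δ = some (false, c.other) := by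
  obtain ⟨k, a, e⟩ := τ
  rcases h with rfl | rfl
  · rw [ray4_of_sub_eq a e (δ := δ + 4) (ε := 2) (by ring),
      ray4_of_sub_eq a e (δ := δ) (ε := 6) (by ring_nf; rfl)]
    revert a e; decide
  · rw [ray4_of_sub_eq a e (δ := δ + 4) (ε := 6) (by ring_nf; rfl),
      ray4_of_sub_eq a e (δ := δ) (ε := 2) (by ring_nf; rfl)]
    revert a e; decide

/-- The position of an arrow that leaves a `C₈` crossing at `45°` to its axis is determined, up to
a half turn, by the color of the arrow. -/
lemma Crossing.sub_axis_of_ray8 (τ : Crossing) {δ : ZMod 8} {c : TileColor}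
    (h : ¬ IsStraight (δ - τ.axis)) (hr : τ.ray8 δ = some (true, c)) :
    (c = .red ∧ (δ - τ.axis = 1 ∨ δ - τ.axis = 5)) ∨
    (c = .green ∧ (δ - τ.axis = 3 ∨ δ - τ.axis = 7)) := by
  obtain ⟨k, a, e⟩ := τ
  rw [ray8_of_sub_eq a e rfl] at hr
  generalize δ - k = x at *
  revert a e c x; decide

lemma Ray.flip_flip (r : Ray) : r.flip.flip = r := by
  cases r <;> simp [Ray.flip]

namespace IsCorrectLattice

variable {σ : GaussianInt → Crossing}

lemma rays_coarsen_corner {o : GaussianInt} (ho : ¬ IsCenter o) {q : GaussianInt}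
    (hq : ¬ IsCenter q) (δ : ZMod 8) :
    rays (coarsen σ o) q δ = rays σ (o + oneAddI * q) (δ + 1) := by
  rw [rays, rays, if_neg hq, if_neg (not_isCenter_lift ho q), coarsen, Crossing.ray8_turn]

/-- Unit steps of the coarser lattice are sides of the finer squares, whose arrows remain. -/
lemma rays_coarsen_straight (h : IsCorrectLattice σ) {o : GaussianInt} (ho : ¬ IsCenter o)
    (ht : IsTangential σ o) (q : GaussianInt) {δ : ZMod 8} (hδ : IsStraight δ) :
    rays (coarsen σ o) q δ = rays σ (o + oneAddI * q) (δ + 1) := by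
  by_cases hq : IsCenter q
  · have hs := h.not_isStraight_axis (not_isCenter_lift ho q) ((h.isTangential_lift ho ht q).2 hq)
    rw [rays, rays, if_pos hq, if_neg (not_isCenter_lift ho q), coarsen, Crossing.ray4_eq_ray8,
      Crossing.ray8_turn]
    rw [show δ - ((σ (o + oneAddI * q)).axis - 1) = δ - (σ (o + oneAddI * q)).axis + 1 by ring,
      isStraight_add_one, isStraight_sub]
    tauto
  · exact rays_coarsen_corner ho hq δ

/-- At the centers of the coarser squares the diagonal rays are erased. -/
lemma rays_coarsen_center (h : IsCorrectLattice σ) {o : GaussianInt} (ho : ¬ IsCenter o)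
    (ht : IsTangential σ o) {q : GaussianInt} (hq : IsCenter q) {δ : ZMod 8}
    (hδ : ¬ IsStraight δ) : rays (coarsen σ o) q δ = none := by
  have hs := h.not_isStraight_axis (not_isCenter_lift ho q) ((h.isTangential_lift ho ht q).2 hq)
  rw [rays, if_pos hq, coarsen, Crossing.ray4_eq_none]
  rw [show δ - ((σ (o + oneAddI * q)).axis - 1) = δ - (σ (o + oneAddI * q)).axis + 1 by ring,
    isStraight_add_one, isStraight_sub]
  tauto

/-- Erasing the arrows perpendicular to the axes of the squares leaves a correct tiling by larger
squares, centered at the tangential corners: there all four unit arrows are erased, while at the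
other corners none is. -/
theorem coarsen (h : IsCorrectLattice σ) {o : GaussianInt} (ho : ¬ IsCenter o)
    (ht : IsTangential σ o) : IsCorrectLattice (coarsen σ o) where
  straight q hq := by
    have hs := h.not_isStraight_axis (not_isCenter_lift ho q) ((h.isTangential_lift ho ht q).2 hq)
    rw [← sub_add_cancel (σ (o + oneAddI * q)).axis 1, isStraight_add_one, not_not] at hs
    exact hs
  fit q δ := by
    by_cases hδ : IsStraight δ
    · have hδ' : IsStraight (δ + 4) := (isStraight_add_four δ).2 hδ
      rw [h.rays_coarsen_straight ho ht _ hδ, h.rays_coarsen_straight ho ht _ hδ', mul_add,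
        oneAddI_mul_step hδ, ← add_assoc, add_right_comm δ, h.fit]
    · have hδ' : ¬ IsStraight (δ + 4) := fun hh => hδ ((isStraight_add_four δ).1 hh)
      by_cases hq : IsCenter q
      · rw [h.rays_coarsen_center ho ht hq hδ, h.rays_coarsen_center ho ht _ hδ']
        · rfl
        · rw [isCenter_add_step]; tauto
      · -- the new arrow consists of two old ones, on the axis of a square between radial corners
        have hq' : ¬ IsCenter (q + step δ) := by rw [isCenter_add_step]; tauto
        have hv := not_isCenter_lift ho q
        have hε := (isStraight_add_one δ).2 hδ
        have hm : IsCenter (o + oneAddI * q + step (δ + 1)) := by rw [isCenter_add_step]; tauto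
        rw [rays_coarsen_corner ho hq, rays_coarsen_corner ho hq', mul_add,
          oneAddI_mul_step' hδ, ← add_assoc, ← add_assoc, add_right_comm δ, h.fit,
          ← h.fit (o + oneAddI * q)]
        rw [rays_of_center hm, rays_of_center hm]
        refine ((Crossing.ray4_add_four _ ?_)).symm
        have hr := mt (h.isTangential_lift ho ht q).1 hq
        rw [h.isTangential_iff hv hε] at hr
        have hs := h.straight _ hm
        generalize (σ (o + oneAddI * q + step (δ + 1))).axis = x at *
        generalize δ + 1 = ε at *
        clear hm hv hq hq' hδ hδ' ht ho h
        revert x ε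
        decide
  perp q hq δ hδ := by
    have hv := not_isCenter_lift ho q
    have hv' := not_isCenter_lift ho (q + step δ)
    have ht1 := (h.isTangential_lift ho ht q).2 hq
    have ht2 := (h.isTangential_lift ho ht (q + step δ)).2 (by rw [isCenter_add_step]; tauto)
    have hε := (isStraight_add_one δ).2 hδ
    have hε' := (isStraight_add_four (δ + 1)).2 hε
    have hm : IsCenter (o + oneAddI * q + step (δ + 1)) := by rw [isCenter_add_step]; tauto
    have hs1 := h.not_isStraight_axis hv ht1
    have hs2 := h.not_isStraight_axis hv' ht2
    have e : o + oneAddI * (q + step δ) =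
        o + oneAddI * q + step (δ + 1) + step (δ + 1) := by
      rw [mul_add, oneAddI_mul_step' hδ]; ring
    have f1 := h.fit (o + oneAddI * q) (δ + 1)
    have f2 := h.fit (o + oneAddI * q + step (δ + 1)) (δ + 1)
    -- the old square between the two new centers sees them in the directions perpendicular to its
    -- axis, so the arrows towards it from the two centers have different colors
    obtain ⟨c, c1, c2⟩ := Crossing.ray4_perp _ ((h.isTangential_iff hv hε).1 ht1)
    rw [← e] at f2
    rw [rays, rays, if_pos hm, if_neg hv, c1] at f1
    rw [rays, rays, if_pos hm, if_neg hv', c2] at f2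
    replace f1 := congrArg Ray.flip f1
    rw [Ray.flip_flip] at f1
    have g1 := Crossing.sub_axis_of_ray8 _ (by rw [isStraight_sub]; tauto) f1.symm
    have g2 := Crossing.sub_axis_of_ray8 _ (by rw [isStraight_sub]; tauto) f2
    simp only [_root_.coarsen]
    generalize (σ (o + oneAddI * (q + step δ))).axis = y at *
    generalize (σ (o + oneAddI * q)).axis = x at *
    generalize δ + 1 = ε at *
    clear hm hv hv' hq f1 f2 c1 c2 e hs1 hs2 hε hε' ht1 ht2 hδ ht ho h
    have hx : x = ε - (ε - x) := by ring
    have hy : y = ε + 4 - (ε + 4 - y) := by ring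
    cases c <;> simp [TileColor.other] at g1 g2 <;> rcases g1 with g1 | g1 <;>
      rcases g2 with g2 | g2 <;> rw [g1] at hx <;> rw [g2] at hy <;> subst hx <;> subst hy <;>
      clear g1 g2 <;> revert ε <;> decide

/-- Every even period gives rise to a period of the coarser tiling that is shorter by the factor
`√2`, and it is even again because the centers of the larger squares are mapped to centers. -/
theorem not_periodic : ∀ (n : ℕ) (σ : GaussianInt → Crossing), IsCorrectLattice σ →
    ∀ a : GaussianInt, IsCenter a → a ≠ 0 → a.norm.natAbs ≤ n → ¬ ∀ p, σ (p + a) = σ p := by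
  intro n
  induction n with
  | zero =>
    intro σ h a _ ha hn
    exact absurd hn (by simpa [Zsqrtd.norm_eq_zero_iff] using ha)
  | succ n ih =>
    intro σ h a hc ha hn hp
    obtain ⟨o, ho, ht⟩ := h.exists_isTangential
    obtain ⟨b, rfl⟩ := hc.exists_eq_mul
    have hper : ∀ q, o + oneAddI * (q + b) = o + oneAddI * q + oneAddI * b := fun q => by ring
    refine ih (_root_.coarsen σ o) (h.coarsen ho ht) b ?_ ?_ ?_ ?_
    · rw [← h.isTangential_lift ho ht, IsTangential, add_right_comm, hp]
      exact ht
    · rintro rfl; simp at ha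
    · have hb : b ≠ 0 := by rintro rfl; simp at ha
      have hb' : b.norm.natAbs ≠ 0 := by simpa using hb
      rw [Zsqrtd.norm_mul, Int.natAbs_mul, show (oneAddI.norm).natAbs = 2 by decide] at hn
      omega
    · intro q
      simp only [_root_.coarsen, hper, hp]

end IsCorrectLattice

/-! ### Tilings of the plane by convex sets -/

open Metric in
/-- Tiles that contain balls of a fixed radius and lie in balls of a fixed radius are locally
finite, since their interiors are disjoint. Hence some tile contains an initial part of a given
segment. -/
lemma IsPlaneTiling.exists_segment {α : Type} {region : α → Set ℂ} {T : Set α}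
    (hT : IsPlaneTiling region T) {r R : ℝ} (hr : 0 < r) (m : α → ℂ)
    (hin : ∀ t, ball (m t) r ⊆ region t) (hout : ∀ t, region t ⊆ closedBall (m t) R)
    (hcl : ∀ t, IsClosed (region t)) (x w : ℂ) :
    ∃ t ∈ T, x ∈ region t ∧ ∃ ε : ℝ, 0 < ε ∧ x + ε * w ∈ region t := by
  let S : Set α := {t ∈ T | (region t ∩ closedBall x ‖w‖).Nonempty}
  have hS : S.Finite := by
    let As : S → Set ℂ := fun t => interior (region t)
    have hfin := MeasureTheory.Measure.finite_const_le_meas_of_disjoint_iUnion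
      (MeasureTheory.volume : MeasureTheory.Measure ℂ) (ε := MeasureTheory.volume (ball (0 : ℂ) r))
      (Metric.measure_ball_pos _ _ hr) (As := As)
      (fun t => isOpen_interior.measurableSet)
      (fun t t' h => hT.1 t.2.1 t'.2.1 (fun hh => h (Subtype.ext hh)))
      (by
        refine ne_top_of_le_ne_top (MeasureTheory.measure_closedBall_lt_top (x := x) (r := ‖w‖ + R + R)).ne
          (MeasureTheory.measure_mono (Set.iUnion_subset ?_))
        rintro ⟨t, _, y, hy, hy'⟩ z hz
        have h1 := mem_closedBall.1 (hout t hy)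
        have h2 := mem_closedBall.1 (hout t (interior_subset hz))
        have h3 := mem_closedBall.1 hy'
        rw [mem_closedBall]
        linarith [dist_triangle z (m t) x, dist_triangle (m t) y x, dist_comm y (m t)])
    have hall : {t : S | MeasureTheory.volume (ball (0 : ℂ) r) ≤
        MeasureTheory.volume (As t)} = Set.univ := by
      refine Set.eq_univ_of_forall fun t => ?_
      have : MeasureTheory.volume (ball (0 : ℂ) r) = MeasureTheory.volume (ball (m t) r) := by
        rw [Complex.volume_ball, Complex.volume_ball]
      rw [Set.mem_ofPred_eq, this]
      exact MeasureTheory.measure_mono (interior_maximal (hin t) isOpen_ball)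
    rw [hall] at hfin
    have := Set.finite_univ_iff.1 hfin
    exact Set.toFinite S
  -- points of the segment that tend to `x`; infinitely many of them lie in the same tile
  let y : ℕ → ℂ := fun n => x + ((1 / ((n : ℝ) + 1) : ℝ) : ℂ) * w
  have hy : Filter.Tendsto y Filter.atTop (nhds x) := by
    have h1 := (Complex.continuous_ofReal.tendsto 0).comp
      (tendsto_one_div_add_atTop_nhds_zero_nat (𝕜 := ℝ))
    have h2 := (h1.mul_const w).const_add x
    simpa [y, Function.comp_def] using h2
  have hex : ∀ n, ∃ t ∈ S, y n ∈ region t := by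
    intro n
    have : y n ∈ ⋃ t ∈ T, region t := hT.2 ▸ Set.mem_univ _
    obtain ⟨t, ht, hyt⟩ := Set.mem_iUnion₂.1 this
    refine ⟨t, ⟨ht, y n, hyt, ?_⟩, hyt⟩
    have hn : (0 : ℝ) ≤ 1 / ((n : ℝ) + 1) := by positivity
    have hn1 : 1 / ((n : ℝ) + 1) ≤ 1 := by
      rw [div_le_one (by positivity)]; linarith [Nat.cast_nonneg (α := ℝ) n]
    rw [mem_closedBall, dist_eq_norm, add_sub_cancel_left, norm_mul, Complex.norm_real,
      Real.norm_of_nonneg hn]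
    exact mul_le_of_le_one_left (norm_nonneg w) hn1
  obtain ⟨t, ht, hf⟩ := (Filter.frequently_exists_finite hS).1
    (Filter.Frequently.of_forall (f := Filter.atTop) hex)
  obtain ⟨n, hn⟩ := hf.exists
  exact ⟨t, ht.1, (hcl t).mem_of_frequently_of_tendsto hf hy, _, by positivity, hn⟩

/-- A tile does not reach into the interior of another one. -/
lemma IsPlaneTiling.eq_of_mem {α : Type} {region : α → Set ℂ} {T : Set α}
    (hT : IsPlaneTiling region T) (hconv : ∀ t, Convex ℝ (region t)) {r : ℝ} (hr : 0 < r)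
    (m : α → ℂ) (hin : ∀ t, Metric.ball (m t) r ⊆ region t) {t t' : α} (ht : t ∈ T)
    (ht' : t' ∈ T) (h : m t ∈ region t') : t = t' := by
  have hint : ∀ t, m t ∈ interior (region t) := fun t =>
    interior_maximal (hin t) Metric.isOpen_ball (Metric.mem_ball_self hr)
  by_contra hne
  have hc : m t ∈ closure (interior (region t')) := by
    rw [(hconv t').closure_interior_eq_closure_of_nonempty_interior ⟨_, hint t'⟩]
    exact subset_closure h
  obtain ⟨y, hy, hy'⟩ := mem_closure_iff.1 hc _ isOpen_interior (hint t)
  exact Set.disjoint_left.1 (hT.1 ht ht' hne) hy hy'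

lemma ball_subset_affine_image {c u : ℂ} (hu : u ≠ 0) {K : Set ℂ} {k : ℂ} {r : ℝ}
    (h : Metric.ball k r ⊆ K) :
    Metric.ball (c + u * k) (‖u‖ * r) ⊆ (fun z => c + u * z) '' K := by
  intro z hz
  refine ⟨(z - c) / u, h ?_, by field_simp; ring⟩
  rw [Metric.mem_ball, dist_eq_norm] at *
  have : z - (c + u * k) = u * ((z - c) / u - k) := by field_simp; ring
  rw [this, norm_mul] at hz
  exact lt_of_mul_lt_mul_left hz (norm_nonneg u)

lemma affine_image_subset_closedBall {c u : ℂ} {K : Set ℂ} {k : ℂ} {r : ℝ}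
    (h : K ⊆ Metric.closedBall k r) :
    (fun z => c + u * z) '' K ⊆ Metric.closedBall (c + u * k) (‖u‖ * r) := by
  rintro _ ⟨z, hz, rfl⟩
  have := h hz
  rw [Metric.mem_closedBall, dist_eq_norm] at *
  have e : c + u * z - (c + u * k) = u * (z - k) := by ring
  rw [e, norm_mul]
  exact mul_le_mul_of_nonneg_left this (norm_nonneg u)

/-! ### Convex hulls in the plane -/

lemma convexHull_affine_image (c u : ℂ) (S : Set ℂ) :
    convexHull ℝ ((fun z => c + u * z) '' S) = (fun z => c + u * z) '' convexHull ℝ S := by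
  let f : ℂ →ᵃ[ℝ] ℂ := (LinearMap.mulLeft ℝ u).toAffineMap + AffineMap.const ℝ ℂ c
  have hf : (fun z => c + u * z) = f := by
    ext z; simp [f, add_comm]
  rw [hf, AffineMap.image_convexHull]

lemma isLinearMap_re : IsLinearMap ℝ Complex.re := ⟨fun _ _ => rfl, fun _ _ => by simp⟩
lemma isLinearMap_im : IsLinearMap ℝ Complex.im := ⟨fun _ _ => rfl, fun _ _ => by simp⟩
lemma isLinearMap_re_add_im : IsLinearMap ℝ (fun z : ℂ => z.re + z.im) :=
  ⟨fun _ _ => by simp; ring, fun _ _ => by simp; ring⟩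
lemma isLinearMap_re_sub_im : IsLinearMap ℝ (fun z : ℂ => z.re - z.im) :=
  ⟨fun _ _ => by simp; ring, fun _ _ => by simp; ring⟩

lemma convexHull_triangle : convexHull ℝ {0, 1, Complex.I} =
    {z : ℂ | 0 ≤ z.re ∧ 0 ≤ z.im ∧ z.re + z.im ≤ 1} := by
  apply subset_antisymm
  · refine convexHull_min ?_ ((convex_halfSpace_ge isLinearMap_re 0).inter
      ((convex_halfSpace_ge isLinearMap_im 0).inter (convex_halfSpace_le isLinearMap_re_add_im 1)))
    rintro z (rfl | rfl | rfl) <;> simp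
  · rintro z ⟨h1, h2, h3⟩
    have hz := (convex_convexHull ℝ ({0, 1, Complex.I} : Set ℂ)).sum_mem (t := Finset.univ)
      (w := ![1 - z.re - z.im, z.re, z.im]) (z := ![0, 1, Complex.I])
      (by intro i _; fin_cases i <;> simp <;> linarith)
      (by simp [Fin.sum_univ_succ])
      (by intro i _; apply subset_convexHull; fin_cases i <;> simp)
    convert hz using 1
    apply Complex.ext <;> simp [Fin.sum_univ_succ]

lemma convexHull_square : convexHull ℝ {1, Complex.I, -1, -Complex.I} =
    {z : ℂ | |z.re| + |z.im| ≤ 1} := by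
  apply subset_antisymm
  · refine (convexHull_min (t := {z : ℂ | z.re + z.im ≤ 1} ∩ ({z : ℂ | -1 ≤ z.re + z.im} ∩
      ({z : ℂ | z.re - z.im ≤ 1} ∩ {z : ℂ | -1 ≤ z.re - z.im}))) ?_ ?_).trans ?_
    · rintro z (rfl | rfl | rfl | rfl) <;> simp
    · exact ((convex_halfSpace_le isLinearMap_re_add_im 1).inter
        ((convex_halfSpace_ge isLinearMap_re_add_im _).inter
        ((convex_halfSpace_le isLinearMap_re_sub_im 1).inter
        (convex_halfSpace_ge isLinearMap_re_sub_im _))))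
    · rintro z ⟨h1, h2, h3, h4⟩
      simp only [Set.mem_ofPred_eq] at *
      rcases abs_cases z.re with h | h <;> rcases abs_cases z.im with h' | h' <;> linarith
  · intro z h
    simp only [Set.mem_ofPred_eq] at h
    -- the slack `1 - |re z| - |im z|` is distributed equally over the four corners
    let e := (1 - |z.re| - |z.im|) / 4
    have he : 0 ≤ e := by simp only [e]; linarith
    have hz := (convex_convexHull ℝ ({1, Complex.I, -1, -Complex.I} : Set ℂ)).sum_mem
      (t := Finset.univ)
      (w := ![(|z.re| + z.re) / 2 + e, (|z.im| + z.im) / 2 + e, (|z.re| - z.re) / 2 + e,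
        (|z.im| - z.im) / 2 + e]) (z := ![1, Complex.I, -1, -Complex.I])
      (by
        intro i _
        fin_cases i <;> simp <;>
          linarith [neg_abs_le z.re, neg_abs_le z.im, le_abs_self z.re, le_abs_self z.im])
      (by simp [Fin.sum_univ_succ, e]; ring)
      (by intro i _; apply subset_convexHull; fin_cases i <;> simp)
    convert hz using 1
    apply Complex.ext <;> simp [Fin.sum_univ_succ] <;> ring

/-! ### Lattice steps in the plane -/

lemma toComplex_step_re (δ : ZMod 8) : ((step δ : GaussianInt) : ℂ).re = ((step δ).re : ℝ) :=
  (GaussianInt.intCast_re _).symm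

lemma toComplex_step_im (δ : ZMod 8) : ((step δ : GaussianInt) : ℂ).im = ((step δ).im : ℝ) :=
  (GaussianInt.intCast_im _).symm

/-- The lengths of the arrows are determined by their directions. -/
lemma eq_of_pos_mul_step {t : ℝ} (ht : 0 < t) {δ ε : ZMod 8}
    (h : (t : ℂ) * (step δ : ℂ) = (step ε : ℂ)) : ε = δ := by
  have hr := congrArg Complex.re h
  have hi := congrArg Complex.im h
  rw [Complex.re_ofReal_mul, toComplex_step_re, toComplex_step_re] at hr
  rw [Complex.im_ofReal_mul, toComplex_step_im, toComplex_step_im] at hi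
  have key : ∀ x y : ℤ, x ∈ ({-1, 0, 1} : Finset ℤ) → y ∈ ({-1, 0, 1} : Finset ℤ) →
      t * (x : ℝ) = (y : ℝ) → y = x := by
    intro x y hx hy hxy
    simp only [Finset.mem_insert, Finset.mem_singleton] at hx hy
    rcases hx with rfl | rfl | rfl <;> rcases hy with rfl | rfl | rfl <;>
      first | rfl | (exfalso; push_cast at hxy; linarith)
  have hm : ∀ δ, (step δ).re ∈ ({-1, 0, 1} : Finset ℤ) ∧ (step δ).im ∈ ({-1, 0, 1} : Finset ℤ) := by
    decide
  have inj : ∀ δ ε, (step ε).re = (step δ).re → (step ε).im = (step δ).im → ε = δ := by decide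
  exact inj _ _ (key _ _ (hm _).1 (hm _).1 hr) (key _ _ (hm _).2 (hm _).2 hi)

lemma toComplex_step_ne_zero (δ : ZMod 8) : (step δ : ℂ) ≠ 0 := by
  have : ∀ δ, step δ ≠ 0 := by decide
  simpa using this δ

lemma mul_step_inj {s : ℂ} (hs : s ≠ 0) {δ ε : ZMod 8} :
    s * (step δ : ℂ) = s * (step ε : ℂ) ↔ δ = ε := by
  have : ∀ δ ε, step δ = step ε → δ = ε := by decide
  constructor
  · intro h
    exact this _ _ (by simpa [hs] using h)
  · rintro rfl; rfl

lemma I_mul_step (δ : ZMod 8) : Complex.I * (step δ : ℂ) = (step (δ + 2) : ℂ) := by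
  have h : ∀ δ, (⟨0, 1⟩ : GaussianInt) * step δ = step (δ + 2) := by decide
  have hI : ((⟨0, 1⟩ : GaussianInt) : ℂ) = Complex.I := by
    simpa using GaussianInt.toComplex_def' 0 1
  rw [← h, GaussianInt.toComplex_mul, hI]

lemma toComplex_oneAddI : ((oneAddI : GaussianInt) : ℂ) = 1 + Complex.I := by
  simpa using GaussianInt.toComplex_def' 1 1

lemma one_add_I_mul_step (δ : ZMod 8) :
    ∃ t : ℝ, 0 < t ∧ (1 + Complex.I) * (step δ : ℂ) = t * (step (δ + 1) : ℂ) := by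
  have e : (1 + Complex.I) * (step δ : ℂ) = ((oneAddI * step δ : GaussianInt) : ℂ) := by
    rw [GaussianInt.toComplex_mul, toComplex_oneAddI]
  by_cases h : IsStraight δ
  · exact ⟨1, one_pos, by rw [e, oneAddI_mul_step h]; simp⟩
  · exact ⟨2, two_pos, by
      rw [e, oneAddI_mul_step' h, GaussianInt.toComplex_add]; push_cast; ring⟩

lemma toComplex_step_add_four (δ : ZMod 8) : (step (δ + 4) : ℂ) = -(step δ : ℂ) := by
  rw [step_add_four, GaussianInt.toComplex_neg]

lemma Crossing.ray8_inj {σ τ : Crossing} (h : ∀ δ, σ.ray8 δ = τ.ray8 δ) : σ = τ := by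
  obtain ⟨k, a, e⟩ := σ
  obtain ⟨k', a', e'⟩ := τ
  have key : ∀ (x : ZMod 8) (a e a' e' : TileColor), (∀ ε : ZMod 8,
      (⟨0, a, e⟩ : Crossing).ray8 ε = (⟨0, a', e'⟩ : Crossing).ray8 (ε + x)) →
      x = 0 ∧ a = a' ∧ e = e' := by decide
  obtain ⟨h1, rfl, rfl⟩ := key (k - k') a e a' e' (fun ε => by
    rw [← ray8_of_sub_eq a e (k := k) (δ := k + ε) (by ring),
      ← ray8_of_sub_eq a' e' (k := k') (δ := k + ε) (by ring)]
    exact h _)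
  rw [sub_eq_zero.1 h1]

lemma Crossing.ray4_inj {σ τ : Crossing} (h : ∀ δ, σ.ray4 δ = τ.ray4 δ) : σ = τ := by
  obtain ⟨k, a, e⟩ := σ
  obtain ⟨k', a', e'⟩ := τ
  have key : ∀ (x : ZMod 8) (a e a' e' : TileColor), (∀ ε : ZMod 8,
      (⟨0, a, e⟩ : Crossing).ray4 ε = (⟨0, a', e'⟩ : Crossing).ray4 (ε + x)) →
      x = 0 ∧ a = a' ∧ e = e' := by decide
  obtain ⟨h1, rfl, rfl⟩ := key (k - k') a e a' e' (fun ε => by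
    rw [← ray4_of_sub_eq a e (k := k) (δ := k + ε) (by ring),
      ← ray4_of_sub_eq a' e' (k := k') (δ := k + ε) (by ring)]
    exact h _)
  rw [sub_eq_zero.1 h1]

/-- A crossing is determined by its rays. -/
lemma rays_inj {σ τ : GaussianInt → Crossing} {p q : GaussianInt} (hpq : IsCenter p ↔ IsCenter q)
    (h : ∀ δ, rays σ p δ = rays τ q δ) : σ p = τ q := by
  by_cases hp : IsCenter p
  · simp only [rays_of_center hp, rays_of_center (hpq.1 hp)] at h
    exact Crossing.ray4_inj h
  · simp only [rays_of_corner hp, rays_of_corner (mt hpq.2 hp)] at h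
    exact Crossing.ray8_inj h

/-- The arrows of `X` at `v` are described by `R`. -/
def ShowsRays (X : Set Arrow) (s v : ℂ) (R : ZMod 8 → Ray) : Prop :=
  ∀ δ c, (⟨v, v + s * step δ, c⟩ ∈ X ↔ R δ = some (true, c)) ∧
    (⟨v + s * step δ, v, c⟩ ∈ X ↔ R δ = some (false, c))

/-- All arrows of `X` have the directions and lengths of the steps of the lattice. -/
def HasStepArrows (X : Set Arrow) (s : ℂ) : Prop :=
  ∀ a ∈ X, ∃ δ : ZMod 8, a.tgt = a.src + s * step δ

/-! ### From arrows in the plane to crossings in lattice coordinates -/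

/-- The arrows of `X` that enter or leave `v`. -/
def arrowsAt (X : Set Arrow) (v : ℂ) : Set Arrow := {a | a ∈ X ∧ (a.src = v ∨ a.tgt = v)}

/-- An arrow of a crossing points along a lattice step as soon as its direction does. -/
lemma HasStepArrows.eq_of_dir {X : Set Arrow} {s : ℂ} (hs : s ≠ 0) (hX : HasStepArrows X s)
    {v w : ℂ} {c : TileColor} (hw : ⟨v, w, c⟩ ∈ X ∨ ⟨w, v, c⟩ ∈ X) {t : ℝ} (ht : 0 < t)
    {δ : ZMod 8} (h : w = v + t * (s * step δ)) : w = v + s * step δ := by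
  have : ∃ ε, w = v + s * step ε := by
    rcases hw with hw | hw
    · obtain ⟨ε, hε⟩ := hX _ hw
      exact ⟨ε, hε⟩
    · obtain ⟨ε, hε⟩ := hX _ hw
      refine ⟨ε + 4, ?_⟩
      simp only at hε
      rw [hε, toComplex_step_add_four]; ring
  obtain ⟨ε, hε⟩ := this
  have h1 : (t : ℂ) * (step δ : ℂ) = (step ε : ℂ) := by
    apply mul_left_cancel₀ hs
    linear_combination hε - h
  rw [hε, eq_of_pos_mul_step ht h1]

/-- All arrows of a `C₄` crossing point along lattice steps if all arrows of `X` do. -/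
lemma IsCrossingC4.showsRays {X : Set Arrow} {s : ℂ} (hs : s ≠ 0) (hX : HasStepArrows X s)
    {v d : ℂ} (h : IsCrossingC4 (arrowsAt X v) v d) :
    ∃ σ : Crossing, (∃ ρ : ℝ, 0 < ρ ∧ d = ρ * (s * step σ.axis)) ∧ ShowsRays X s v σ.ray4 := by
  obtain ⟨-, c, e, r, hr, hX4⟩ := h
  have hmem : ∀ a, a ∈ arrowsAt X v → a ∈ X := fun a ha => ha.1
  have m0 := hmem ⟨v - r 0 * d, v, c⟩ (by rw [hX4]; simp)
  have m1 := hmem ⟨v, v + r 1 * d, c⟩ (by rw [hX4]; simp)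
  have m2 := hmem ⟨v + r 2 * (Complex.I * d), v, e⟩ (by rw [hX4]; simp)
  have m3 := hmem ⟨v - r 3 * (Complex.I * d), v, e.other⟩ (by rw [hX4]; simp)
  obtain ⟨k, hk⟩ := hX _ m1
  simp only [add_right_inj] at hk
  have h1 : (r 1 : ℂ) ≠ 0 := by exact_mod_cast (hr 1).ne'
  have hd : d = ((1 / r 1 : ℝ) : ℂ) * (s * step k) := by
    push_cast; field_simp; linear_combination hk
  have t0 := hX.eq_of_dir hs (Or.inr m0) (t := r 0 / r 1) (δ := k + 4) (div_pos (hr 0) (hr 1))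
    (by rw [hd, toComplex_step_add_four]; push_cast; field_simp; ring)
  have t2 := hX.eq_of_dir hs (Or.inr m2) (t := r 2 / r 1) (δ := k + 2) (div_pos (hr 2) (hr 1))
    (by rw [hd, ← I_mul_step]; push_cast; field_simp)
  have t3 := hX.eq_of_dir hs (Or.inr m3) (t := r 3 / r 1) (δ := k + 2 + 4)
    (div_pos (hr 3) (hr 1))
    (by rw [hd, toComplex_step_add_four, ← I_mul_step]; push_cast; field_simp; ring)
  rw [t0, t2, t3, hk] at hX4
  refine ⟨⟨k, c, e⟩, ⟨1 / r 1, one_div_pos.2 (hr 1), hd⟩, ?_⟩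
  have hv : ∀ δ : ZMod 8, ¬ s * (step δ : ℂ) = 0 := fun δ => by
    simpa [hs] using toComplex_step_ne_zero δ
  intro δ c'
  have hδ : δ = k + (δ - k) := by ring
  generalize δ - k = ε at hδ
  subst hδ
  have o1 : ⟨v, v + s * step (k + ε), c'⟩ ∈ X ↔
    (⟨v, v + s * step (k + ε), c'⟩ : Arrow) ∈ arrowsAt X v :=
      ⟨fun h => ⟨h, Or.inl rfl⟩, fun h => h.1⟩
  have o2 : ⟨v + s * step (k + ε), v, c'⟩ ∈ X ↔
    (⟨v + s * step (k + ε), v, c'⟩ : Arrow) ∈ arrowsAt X v :=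
      ⟨fun h => ⟨h, Or.inr rfl⟩, fun h => h.1⟩
  rw [o1, o2, hX4, Crossing.ray4_of_sub_eq c e (k := k) (δ := k + ε) (ε := ε) (by ring)]
  simp only [Set.mem_insert_iff, Set.mem_singleton_iff, Arrow.mk.injEq, add_right_inj,
    mul_step_inj hs, left_eq_add, add_eq_left, hv, false_and, and_false, or_false, false_or,
    true_and, add_assoc]
  clear hX4 o1 o2 t0 t2 t3 m0 m1 m2 m3 hd hk
  constructor
  · revert ε c' c e; decide
  · revert ε c' c e; decide

/-- All arrows of a `C₈` crossing point along lattice steps if all arrows of `X` do. -/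
lemma IsCrossingC8.showsRays {X : Set Arrow} {s : ℂ} (hs : s ≠ 0) (hX : HasStepArrows X s)
    {v d : ℂ} (h : IsCrossingC8 (arrowsAt X v) v d) :
    ∃ σ : Crossing, ShowsRays X s v σ.ray8 := by
  obtain ⟨-, c, e, r, hr, hX8⟩ := h
  have hmem : ∀ a, a ∈ arrowsAt X v → a ∈ X := fun a ha => ha.1
  have m0 := hmem ⟨v - r 0 * d, v, c⟩ (by rw [hX8]; simp)
  have m1 := hmem ⟨v, v + r 1 * d, c⟩ (by rw [hX8]; simp)
  have m2 := hmem ⟨v + r 2 * (Complex.I * d), v, e⟩ (by rw [hX8]; simp)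
  have m3 := hmem ⟨v - r 3 * (Complex.I * d), v, e.other⟩ (by rw [hX8]; simp)
  have m4 := hmem ⟨v, v + r 4 * ((1 + Complex.I) * d), .red⟩ (by rw [hX8]; simp)
  have m5 := hmem ⟨v, v - r 5 * ((1 + Complex.I) * d), .red⟩ (by rw [hX8]; simp)
  have m6 := hmem ⟨v, v + r 6 * ((Complex.I - 1) * d), .green⟩ (by rw [hX8]; simp)
  have m7 := hmem ⟨v, v - r 7 * ((Complex.I - 1) * d), .green⟩ (by rw [hX8]; simp)
  obtain ⟨k, hk⟩ := hX _ m1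
  simp only [add_right_inj] at hk
  have h1 : (r 1 : ℂ) ≠ 0 := by exact_mod_cast (hr 1).ne'
  have hd : d = ((1 / r 1 : ℝ) : ℂ) * (s * step k) := by
    push_cast; field_simp; linear_combination hk
  obtain ⟨μ, hμ, e1⟩ := one_add_I_mul_step k
  have e3 : (Complex.I - 1) * (step k : ℂ) = μ * (step (k + 1 + 2) : ℂ) := by
    rw [← I_mul_step]
    linear_combination Complex.I * e1 - (step k : ℂ) * Complex.I_mul_I
  have t0 := hX.eq_of_dir hs (Or.inr m0) (t := r 0 / r 1) (δ := k + 4) (div_pos (hr 0) (hr 1))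
    (by rw [hd, toComplex_step_add_four]; push_cast; field_simp; ring)
  have t2 := hX.eq_of_dir hs (Or.inr m2) (t := r 2 / r 1) (δ := k + 2) (div_pos (hr 2) (hr 1))
    (by rw [hd, ← I_mul_step]; push_cast; field_simp)
  have t3 := hX.eq_of_dir hs (Or.inr m3) (t := r 3 / r 1) (δ := k + 2 + 4)
    (div_pos (hr 3) (hr 1))
    (by rw [hd, toComplex_step_add_four, ← I_mul_step]; push_cast; field_simp; ring)
  have t4 := hX.eq_of_dir hs (Or.inl m4) (t := r 4 / r 1 * μ) (δ := k + 1)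
    (mul_pos (div_pos (hr 4) (hr 1)) hμ)
    (by rw [hd]; push_cast; linear_combination (r 4 : ℂ) / r 1 * s * e1)
  have t5 := hX.eq_of_dir hs (Or.inl m5) (t := r 5 / r 1 * μ) (δ := k + 1 + 4)
    (mul_pos (div_pos (hr 5) (hr 1)) hμ)
    (by
      rw [hd, toComplex_step_add_four]; push_cast
      linear_combination -((r 5 : ℂ) / r 1 * s * e1))
  have t6 := hX.eq_of_dir hs (Or.inl m6) (t := r 6 / r 1 * μ) (δ := k + 1 + 2)
    (mul_pos (div_pos (hr 6) (hr 1)) hμ)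
    (by rw [hd]; push_cast; linear_combination (r 6 : ℂ) / r 1 * s * e3)
  have t7 := hX.eq_of_dir hs (Or.inl m7) (t := r 7 / r 1 * μ) (δ := k + 1 + 2 + 4)
    (mul_pos (div_pos (hr 7) (hr 1)) hμ)
    (by
      rw [hd, toComplex_step_add_four]; push_cast
      linear_combination -((r 7 : ℂ) / r 1 * s * e3))
  rw [t0, t2, t3, t4, t5, t6, t7, hk] at hX8
  refine ⟨⟨k, c, e⟩, ?_⟩
  have hv : ∀ δ : ZMod 8, ¬ s * (step δ : ℂ) = 0 := fun δ => by
    simpa [hs] using toComplex_step_ne_zero δ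
  intro δ c'
  have hδ : δ = k + (δ - k) := by ring
  generalize δ - k = ε at hδ
  subst hδ
  have o1 : ⟨v, v + s * step (k + ε), c'⟩ ∈ X ↔
    (⟨v, v + s * step (k + ε), c'⟩ : Arrow) ∈ arrowsAt X v :=
      ⟨fun h => ⟨h, Or.inl rfl⟩, fun h => h.1⟩
  have o2 : ⟨v + s * step (k + ε), v, c'⟩ ∈ X ↔
    (⟨v + s * step (k + ε), v, c'⟩ : Arrow) ∈ arrowsAt X v :=
      ⟨fun h => ⟨h, Or.inr rfl⟩, fun h => h.1⟩
  rw [o1, o2, hX8, Crossing.ray8_of_sub_eq c e (k := k) (δ := k + ε) (ε := ε) (by ring)]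
  simp only [Set.mem_insert_iff, Set.mem_singleton_iff, Arrow.mk.injEq, add_right_inj,
    mul_step_inj hs, left_eq_add, add_eq_left, hv, false_and, and_false, or_false, false_or,
    true_and, add_assoc]
  clear hX8 o1 o2 t0 t2 t3 t4 t5 t6 t7 m0 m1 m2 m3 m4 m5 m6 m7 hd hk e1 e3
  constructor
  · revert ε c' c e; decide
  · revert ε c' c e; decide

/-- A set of arrows that shows a correct tiling in lattice coordinates has no lattice period. -/
theorem not_periodic_of_showsRays {X : Set Arrow} {s o : ℂ} {σ : GaussianInt → Crossing}
    (hσ : ∀ p : GaussianInt, ShowsRays X s (o + s * p) (rays σ p))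
    (straight : ∀ p, IsCenter p → IsStraight (σ p).axis)
    (perp : ∀ p, IsCenter p → ∀ δ, ¬ IsStraight δ →
      (σ (p + step δ)).axis = (σ p).axis + 2 ∨ (σ (p + step δ)).axis = (σ p).axis + 6)
    {a : GaussianInt} (ha : IsCenter a) (ha0 : a ≠ 0)
    (hper : ∀ x y c, ⟨x + s * a, y + s * a, c⟩ ∈ X ↔ ⟨x, y, c⟩ ∈ X) : False := by
  have ray_ext : ∀ r r' : Ray, (∀ b c, r = some (b, c) ↔ r' = some (b, c)) → r = r' := by
    intro r r' h
    ext ⟨b, c⟩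
    exact h b c
  refine IsCorrectLattice.not_periodic _ σ ⟨straight, ?_, perp⟩ a ha ha0 le_rfl ?_
  · intro p δ
    have e1 : o + s * ((p + step δ : GaussianInt) : ℂ) = o + s * (p : ℂ) + s * step δ := by
      rw [GaussianInt.toComplex_add]; ring
    have e2 : o + s * ((p + step δ : GaussianInt) : ℂ) + s * step (δ + 4) = o + s * (p : ℂ) := by
      rw [GaussianInt.toComplex_add, toComplex_step_add_four]; ring
    apply ray_ext
    intro b c
    have h1 := hσ p δ c
    have h2 := hσ (p + step δ) (δ + 4) c
    rw [e2, e1] at h2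
    have h3 : ∀ (r : Ray) b c, r.flip = some (b, c) ↔ r = some (!b, c) := by decide
    rw [h3]
    cases b
    · exact h2.2.symm.trans h1.1
    · exact h2.1.symm.trans h1.2
  · intro p
    refine rays_inj (by
      simp only [IsCenter, Zsqrtd.re_add, Zsqrtd.im_add, Int.even_add] at *; tauto) ?_
    intro δ
    apply ray_ext
    intro b c
    have h1 := hσ p δ c
    have h2 := hσ (p + a) δ c
    have e1 : o + s * ((p + a : GaussianInt) : ℂ) = o + s * (p : ℂ) + s * a := by
      rw [GaussianInt.toComplex_add]; ring
    rw [e1, add_right_comm _ (s * (a : ℂ)) (s * (step δ : ℂ)), hper, hper] at h2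
    cases b
    · exact h2.2.symm.trans h1.2
    · exact h2.1.symm.trans h1.1

/-! ### Triangular tiles -/

/-- The standard tile: the triangle with vertices `0`, `1` and `i`. -/
def stdTriangle : Set ℂ := {z : ℂ | 0 ≤ z.re ∧ 0 ≤ z.im ∧ z.re + z.im ≤ 1}

/-- A point of the interior of the standard triangle. -/
noncomputable def triangleCenter : ℂ := ⟨1 / 4, 1 / 4⟩

lemma ball_subset_stdTriangle : Metric.ball triangleCenter (1 / 8) ⊆ stdTriangle := by
  intro z hz
  rw [Metric.mem_ball, dist_eq_norm] at hz
  have h1 := abs_lt.1 ((Complex.abs_re_le_norm _).trans_lt hz)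
  have h2 := abs_lt.1 ((Complex.abs_im_le_norm _).trans_lt hz)
  simp only [triangleCenter, Complex.sub_re, Complex.sub_im] at h1 h2
  refine ⟨?_, ?_, ?_⟩ <;> linarith [h1.1, h1.2, h2.1, h2.2]

lemma stdTriangle_subset_closedBall : stdTriangle ⊆ Metric.closedBall triangleCenter 2 := by
  rintro z ⟨h1, h2, h3⟩
  rw [Metric.mem_closedBall, dist_eq_norm]
  refine (Complex.norm_le_abs_re_add_abs_im _).trans ?_
  simp only [triangleCenter, Complex.sub_re, Complex.sub_im]
  have a1 : |z.re - 1 / 4| ≤ 1 := abs_le.2 ⟨by linarith, by linarith⟩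
  have a2 : |z.im - 1 / 4| ≤ 1 := abs_le.2 ⟨by linarith, by linarith⟩
  linarith

lemma mul_step_ne_zero {s : ℂ} (hs : s ≠ 0) (δ : ZMod 8) : s * (step δ : ℂ) ≠ 0 :=
  mul_ne_zero hs (toComplex_step_ne_zero δ)

lemma I_pow_eq_step (r : ℕ) : Complex.I ^ r = (step (2 * (r : ZMod 8)) : ℂ) := by
  induction r with
  | zero =>
    have : step 0 = 1 := by decide
    simp [this]
  | succ n ih =>
    rw [pow_succ, ih, mul_comm, I_mul_step]
    congr 2
    push_cast; ring

lemma isStraight_two_mul (δ : ZMod 8) : IsStraight (2 * δ) := by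
  revert δ; decide

lemma step_mul_step {δ : ZMod 8} (h : IsStraight δ) (ε : ZMod 8) :
    (step δ : ℂ) * (step ε : ℂ) = (step (δ + ε) : ℂ) := by
  have : ∀ δ, IsStraight δ → ∀ ε, step δ * step ε = step (δ + ε) := by decide
  rw [← GaussianInt.toComplex_mul, this δ h]

lemma step_mul_one_add_I {δ : ZMod 8} (h : IsStraight δ) :
    (step δ : ℂ) * (1 + Complex.I) = (step (δ + 1) : ℂ) := by
  rw [← oneAddI_mul_step h, GaussianInt.toComplex_mul, toComplex_oneAddI, mul_comm]

lemma step_add_step_add_two {δ : ZMod 8} (h : IsStraight δ) :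
    (step δ : ℂ) + (step (δ + 2) : ℂ) = (step (δ + 1) : ℂ) := by
  rw [← step_mul_one_add_I h, ← I_mul_step]; ring

lemma step_add_step_add_three {δ : ZMod 8} (h : IsStraight δ) :
    (step δ : ℂ) + (step (δ + 3) : ℂ) = (step (δ + 2) : ℂ) := by
  have : ∀ δ, IsStraight δ → step δ + step (δ + 3) = step (δ + 2) := by decide
  rw [← GaussianInt.toComplex_add, this δ h]

/-- The set of all arrows of a set of triangular tiles. -/
def triArrows (s : ℂ) (T : Set TriTile) : Set Arrow := {a | ∃ t ∈ T, ∃ j, a = t.arrow s j}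

/-- The points `x` and `y` are joined by an arrow of `X`. -/
def AreJoined (X : Set Arrow) (x y : ℂ) : Prop := ∃ c, ⟨x, y, c⟩ ∈ X ∨ ⟨y, x, c⟩ ∈ X

lemma AreJoined.symm {X : Set Arrow} {x y : ℂ} (h : AreJoined X x y) : AreJoined X y x := by
  obtain ⟨c, h⟩ := h
  exact ⟨c, h.symm⟩

lemma ShowsRays.joined_iff {X : Set Arrow} {s v : ℂ} {R : ZMod 8 → Ray} (h : ShowsRays X s v R)
    (δ : ZMod 8) : AreJoined X v (v + s * step δ) ↔ R δ ≠ none := by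
  constructor
  · rintro ⟨c, hc | hc⟩
    · rw [(h δ c).1.1 hc]; simp
    · rw [(h δ c).2.1 hc]; simp
  · intro hR
    obtain ⟨⟨b, c⟩, hbc⟩ := Option.ne_none_iff_exists'.1 hR
    cases b
    · exact ⟨c, Or.inr ((h δ c).2.2 hbc)⟩
    · exact ⟨c, Or.inl ((h δ c).1.2 hbc)⟩

lemma Crossing.ray8_ne_none (τ : Crossing) (δ : ZMod 8) : τ.ray8 δ ≠ none := by
  obtain ⟨k, a, e⟩ := τ
  rw [ray8_of_sub_eq a e rfl]
  generalize δ - k = x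
  revert a e x; decide

lemma Crossing.isStraight_sub_axis (τ : Crossing) {δ : ZMod 8} (h : τ.ray4 δ ≠ none) :
    IsStraight (δ - τ.axis) := by
  by_contra hn
  exact h (τ.ray4_eq_none hn)

namespace TriTile

variable {s : ℂ} (t : TriTile)

/-- The direction of the first leg, counterclockwise. -/
def dir : ZMod 8 := 2 * ((t.rot : ℕ) : ZMod 8)

lemma isStraight_dir : IsStraight t.dir := isStraight_two_mul _

lemma vertex_zero : t.vertex s 0 = t.apex := rfl

lemma vertex_one : t.vertex s 1 = t.apex + s * step t.dir := by
  rw [dir, ← I_pow_eq_step]; rfl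

lemma vertex_two : t.vertex s 2 = t.apex + s * step (t.dir + 2) := by
  have : t.dir + 2 = 2 * (((t.rot + 1 : ℕ)) : ZMod 8) := by
    rw [dir]; push_cast; ring
  rw [this, ← I_pow_eq_step]; rfl

lemma vertex_two' : t.vertex s 2 = t.vertex s 1 + s * step (t.dir + 3) := by
  rw [vertex_one, vertex_two, ← step_add_step_add_three t.isStraight_dir]; ring

lemma vertices_eq : t.vertices s =
    (fun z => t.apex + s * step t.dir * z) '' {0, 1, Complex.I} := by
  have e : (Complex.I * step t.dir : ℂ) = step (t.dir + 2) := I_mul_step _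
  ext z
  simp only [vertices, Set.mem_range, Set.mem_image, Set.mem_insert_iff, Set.mem_singleton_iff,
    exists_eq_or_imp, exists_eq_left, Fin.exists_fin_succ, vertex_zero, mul_zero, add_zero,
    mul_one]
  simp [vertex_one, vertex_two, ← e, mul_assoc, mul_comm Complex.I]

lemma region_eq : t.region s = (fun z => t.apex + s * step t.dir * z) '' stdTriangle := by
  rw [region, vertices_eq, convexHull_affine_image, convexHull_triangle]; rfl

lemma mem_region (hs : s ≠ 0) {z : ℂ} :
    t.apex + s * step t.dir * z ∈ t.region s ↔ z ∈ stdTriangle := by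
  rw [region_eq]
  constructor
  · rintro ⟨w, hw, h⟩
    rwa [← mul_left_cancel₀ (mul_step_ne_zero hs _) (add_left_cancel h)]
  · exact fun h => ⟨z, h, rfl⟩

/-- A point of the interior of the tile. -/
noncomputable def center (s : ℂ) (t : TriTile) : ℂ := t.apex + s * step t.dir * triangleCenter

lemma norm_leg : ‖s * (step t.dir : ℂ)‖ = ‖s‖ := by
  rw [dir, ← I_pow_eq_step]; simp

lemma ball_subset_region (hs : s ≠ 0) : Metric.ball (t.center s) (‖s‖ * (1 / 8)) ⊆ t.region s := by
  rw [region_eq, ← norm_leg t]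
  exact ball_subset_affine_image (mul_step_ne_zero hs _) ball_subset_stdTriangle

lemma region_subset_closedBall : t.region s ⊆ Metric.closedBall (t.center s) (‖s‖ * 2) := by
  rw [region_eq, ← norm_leg t]
  exact affine_image_subset_closedBall stdTriangle_subset_closedBall

lemma isClosed_region : IsClosed (t.region s) :=
  (Set.finite_range _).isClosed_convexHull ℝ

lemma convex_region : Convex ℝ (t.region s) := convex_convexHull ℝ _

lemma vertex_mem_region (j : Fin 3) : t.vertex s j ∈ t.region s :=
  subset_convexHull ℝ _ ⟨j, rfl⟩

lemma hasStepArrows (T : Set TriTile) : HasStepArrows (triArrows s T) s := by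
  rintro _ ⟨t, -, j, rfl⟩
  have key : ∀ j : Fin 3, ∃ δ, t.vertex s (j + 1) = t.vertex s j + s * step δ := by
    intro j
    fin_cases j
    · exact ⟨t.dir, vertex_one t⟩
    · exact ⟨t.dir + 3, vertex_two' t⟩
    · refine ⟨t.dir + 2 + 4, ?_⟩
      rw [toComplex_step_add_four]
      change t.vertex s 0 = t.vertex s 2 + _
      rw [vertex_two, vertex_zero]; ring
  obtain ⟨δ, hδ⟩ := key j
  unfold arrow
  split_ifs
  · exact ⟨δ, hδ⟩
  · refine ⟨δ + 4, ?_⟩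
    simp only
    rw [hδ, toComplex_step_add_four]; ring

variable {t} in
lemma joined {T : Set TriTile} (ht : t ∈ T) (j : Fin 3) :
    AreJoined (triArrows s T) (t.vertex s j) (t.vertex s (j + 1)) := by
  refine ⟨t.sideColor j, ?_⟩
  have h : t.arrow s j ∈ triArrows s T := ⟨t, ht, j, rfl⟩
  unfold arrow at h
  split_ifs at h
  · exact Or.inl h
  · exact Or.inr h

lemma exists_of_joined {T : Set TriTile} {x y : ℂ} (h : AreJoined (triArrows s T) x y) :
    ∃ t ∈ T, x ∈ t.region s ∧ y ∈ t.region s := by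
  have key : ∀ x y c, ⟨x, y, c⟩ ∈ triArrows s T → ∃ t ∈ T, x ∈ t.region s ∧ y ∈ t.region s := by
    rintro x y c ⟨t, ht, j, hj⟩
    refine ⟨t, ht, ?_⟩
    unfold arrow at hj
    split_ifs at hj <;> obtain ⟨rfl, rfl, -⟩ := Arrow.mk.inj hj
    · exact ⟨vertex_mem_region _ _, vertex_mem_region _ _⟩
    · exact ⟨vertex_mem_region _ _, vertex_mem_region _ _⟩
  obtain ⟨c, h | h⟩ := h
  · exact key _ _ _ h
  · obtain ⟨t, ht, h1, h2⟩ := key _ _ _ h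
    exact ⟨t, ht, h2, h1⟩

end TriTile

/-- The squares with half diagonal `1` around the points of even coordinate sum cover the
plane. -/
lemma exists_isCenter_near (z : ℂ) : ∃ p, IsCenter p ∧ |(z - p).re| + |(z - p).im| ≤ 1 := by
  have h1 := abs_le.1 (abs_sub_round ((z.re + z.im) / 2))
  have h2 := abs_le.1 (abs_sub_round ((z.re - z.im) / 2))
  generalize round ((z.re + z.im) / 2) = m at h1
  generalize round ((z.re - z.im) / 2) = n at h2
  refine ⟨⟨m + n, m - n⟩, ⟨m, by simp only; ring⟩, ?_⟩
  rw [Complex.sub_re, Complex.sub_im, GaussianInt.re_toComplex, GaussianInt.im_toComplex]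
  push_cast
  rcases abs_cases (z.re - (m + n)) with h | h <;> rcases abs_cases (z.im - (m - n)) with h' | h' <;>
    linarith [h1.1, h1.2, h2.1, h2.2]

/-- Four rotated copies of the standard triangle cover the square around their common apex. -/
lemma exists_step_mul {z : ℂ} (h : |z.re| + |z.im| ≤ 1) :
    ∃ δ, IsStraight δ ∧ ∃ w ∈ stdTriangle, z = step δ * w := by
  have e : ∀ δ : ZMod 8, (step δ : ℂ) = ⟨(step δ).re, (step δ).im⟩ := fun δ =>
    GaussianInt.toComplex_def₂ _
  rcases abs_cases z.re with ⟨h1, h1'⟩ | ⟨h1, h1'⟩ <;>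
    rcases abs_cases z.im with ⟨h2, h2'⟩ | ⟨h2, h2'⟩
  · exact ⟨0, by decide, z, ⟨by linarith, by linarith, by linarith⟩, by
      rw [e]; apply Complex.ext <;> simp [step]⟩
  · exact ⟨6, by decide, ⟨-z.im, z.re⟩, ⟨by simp only; linarith, by simp only; linarith,
      by simp only; linarith⟩, by rw [e]; apply Complex.ext <;> simp [step]⟩
  · exact ⟨2, by decide, ⟨z.im, -z.re⟩, ⟨by simp only; linarith, by simp only; linarith,
      by simp only; linarith⟩, by rw [e]; apply Complex.ext <;> simp [step]⟩
  · exact ⟨4, by decide, ⟨-z.re, -z.im⟩, ⟨by simp only; linarith, by simp only; linarith,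
      by simp only; linarith⟩, by rw [e]; apply Complex.ext <;> simp [step]⟩

/-! ### Triangular tiles around a given one -/

lemma step_nonneg_iff {δ : ZMod 8} : 0 ≤ (step δ).re ∧ 0 ≤ (step δ).im ↔ δ = 0 ∨ δ = 1 ∨ δ = 2 := by
  revert δ; decide

/-- The vertices of the tile in direction `δ` relative to its apex, in lattice coordinates. -/
def TriTile.offset (δ : ZMod 8) : Fin 3 → GaussianInt := ![0, step δ, step (δ + 2)]

lemma TriTile.vertex_eq {s : ℂ} (t : TriTile) (j : Fin 3) :
    t.vertex s j = t.apex + s * (offset t.dir j : ℂ) := by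
  fin_cases j
  · simp [offset, vertex_zero]
  · exact vertex_one t
  · exact vertex_two t

namespace IsCorrectTriTiling

open TriTile

variable {s : ℂ} {T : Set TriTile}

lemma eq_of_center_mem (h : IsCorrectTriTiling s T) (hs : s ≠ 0) {t t' : TriTile} (ht : t ∈ T)
    (ht' : t' ∈ T) (hc : t.center s ∈ t'.region s) : t = t' :=
  h.tiling.eq_of_mem convex_region (r := ‖s‖ * (1 / 8)) (by positivity) (TriTile.center s)
    (fun t => t.ball_subset_region hs) ht ht' hc

lemma exists_segment (h : IsCorrectTriTiling s T) (hs : s ≠ 0) (x w : ℂ) :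
    ∃ t ∈ T, x ∈ t.region s ∧ ∃ ε : ℝ, 0 < ε ∧ x + ε * w ∈ t.region s :=
  h.tiling.exists_segment (r := ‖s‖ * (1 / 8)) (by positivity) (TriTile.center s)
    (fun t => t.ball_subset_region hs) (fun t => t.region_subset_closedBall)
    (fun t => t.isClosed_region) x w

/-- The crossing at an apex is not of type `C₈`, since an arrow that bisects the right angle would
be a side of a tile that reaches into the interior. -/
lemma crossing_apex (h : IsCorrectTriTiling s T) (hs : s ≠ 0) {t : TriTile} (ht : t ∈ T) :
    ∃ σ : Crossing, IsStraight σ.axis ∧ ShowsRays (triArrows s T) s t.apex σ.ray4 ∧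
      ∃ d, IsCrossingC4 (crossing s T t.apex) t.apex d ∧
        ∃ ρ : ℝ, 0 < ρ ∧ d = ρ * (s * step σ.axis) := by
  obtain ⟨d, hd | hd⟩ := h.crossings t ht t.apex ⟨0, rfl⟩
  · obtain ⟨σ, hρ, hσ⟩ := IsCrossingC4.showsRays (X := triArrows s T) hs (hasStepArrows T) hd
    refine ⟨σ, ?_, hσ, d, hd, hρ⟩
    have h1 := joined (s := s) ht 0
    change AreJoined _ t.apex (t.vertex s 1) at h1
    rw [vertex_one, hσ.joined_iff] at h1
    have h2 := σ.isStraight_sub_axis h1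
    rw [isStraight_sub] at h2
    exact h2.1 t.isStraight_dir
  · exfalso
    obtain ⟨σ, hσ⟩ := IsCrossingC8.showsRays (X := triArrows s T) hs (hasStepArrows T) hd
    have h1 := (hσ.joined_iff (t.dir + 1)).2 (σ.ray8_ne_none _)
    obtain ⟨t', ht', h2, h3⟩ := exists_of_joined h1
    have e : t.apex + s * step (t.dir + 1) = t.apex + s * step t.dir * (1 + Complex.I) := by
      rw [mul_assoc, step_mul_one_add_I t.isStraight_dir]
    have hc : t.center s = (3 / 4 : ℝ) • t.apex + (1 / 4 : ℝ) •
        (t.apex + s * step (t.dir + 1)) := by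
      rw [e, TriTile.center, show triangleCenter = (1 / 4 : ℝ) • (1 + Complex.I) by
        apply Complex.ext <;> simp [triangleCenter]]
      simp only [Complex.real_smul]; push_cast; ring
    have hm : t.center s ∈ t'.region s := by
      rw [hc]
      exact t'.convex_region h2 h3 (by norm_num) (by norm_num) (by norm_num)
    obtain rfl := h.eq_of_center_mem hs ht ht' hm
    rw [e, mem_region _ hs] at h3
    have := h3.2.2
    norm_num at this

/-- A tile that contains the apex of another tile has it as a vertex. -/
lemma apex_mem_vertices (h : IsCorrectTriTiling s T) (hs : s ≠ 0) {t t' : TriTile} (ht : t ∈ T)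
    (ht' : t' ∈ T) (hm : t.apex ∈ t'.region s) : t.apex ∈ t'.vertices s := by
  by_cases hne : t = t'
  · subst hne; exact ⟨0, rfl⟩
  by_contra hv
  have h1 : t.apex ∈ convexHull ℝ (t.vertices s ∩ t'.vertices s) := by
    rw [← h.side_to_side ht ht' hne]
    exact ⟨vertex_mem_region t 0, hm⟩
  have h2 : t.vertices s ∩ t'.vertices s ⊆
      (fun z => t.apex + s * step t.dir * z) '' {z | z.re + z.im = 1} := by
    rintro x ⟨hx, hx'⟩
    rw [vertices_eq] at hx
    obtain ⟨z, rfl | rfl | rfl, rfl⟩ := hx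
    · simp only [mul_zero, add_zero] at hx'
      exact absurd hx' hv
    · exact ⟨1, by simp, rfl⟩
    · exact ⟨Complex.I, by simp, rfl⟩
  have h3 := convexHull_mono h2 h1
  rw [convexHull_affine_image,
    (convex_hyperplane isLinearMap_re_add_im 1).convexHull_eq] at h3
  obtain ⟨z, hz, hz'⟩ := h3
  have : z = 0 := by simpa [mul_step_ne_zero hs] using hz'
  subst this
  simp at hz

/-- Four tiles meet at an apex with their right angles, since the crossing there has no diagonal
arrows. -/
lemma exists_rotated (h : IsCorrectTriTiling s T) (hs : s ≠ 0) {t : TriTile} (ht : t ∈ T)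
    {δ : ZMod 8} (hδ : IsStraight δ) : ∃ t' ∈ T, t'.apex = t.apex ∧ t'.dir = δ := by
  obtain ⟨σ, hax, hσ, -⟩ := h.crossing_apex hs ht
  obtain ⟨t', ht', hx, ε, hε, hy⟩ := h.exists_segment hs t.apex (s * step (δ + 1))
  obtain ⟨j, hj⟩ := h.apex_mem_vertices hs ht ht' hx
  have hno : ∀ ε, ¬ IsStraight ε → ¬ AreJoined (triArrows s T) t.apex (t.apex + s * step ε) := by
    intro ε hε hj
    have := σ.isStraight_sub_axis ((hσ.joined_iff ε).1 hj)
    rw [isStraight_sub] at this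
    exact hε (this.2 hax)
  have hd := t'.isStraight_dir
  have hjo : AreJoined (triArrows s T) (t'.vertex s 1) (t'.vertex s 2) := joined ht' 1
  fin_cases j
  · have hj' : t'.apex = t.apex := hj
    refine ⟨t', ht', hj', ?_⟩
    have e : (step (δ + 1) : ℂ) = step t'.dir * step (δ + 1 - t'.dir) := by
      rw [step_mul_step hd]; congr 2; ring
    rw [← hj', e, show t'.apex + (ε : ℂ) * (s * (step t'.dir * step (δ + 1 - t'.dir))) =
      t'.apex + s * step t'.dir * (ε * step (δ + 1 - t'.dir)) by ring, mem_region _ hs] at hy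
    have h1 := hy.1
    have h2 := hy.2.1
    rw [Complex.re_ofReal_mul, toComplex_step_re] at h1
    rw [Complex.im_ofReal_mul, toComplex_step_im] at h2
    have h3 := (mul_nonneg_iff_of_pos_left hε).1 h1
    have h4 := (mul_nonneg_iff_of_pos_left hε).1 h2
    have h5 := step_nonneg_iff.1 ⟨Int.cast_nonneg_iff.1 h3, Int.cast_nonneg_iff.1 h4⟩
    generalize t'.dir = x at *
    clear * - h5 hd hδ
    revert x δ; decide
  · exfalso
    have hj' : t'.vertex s 1 = t.apex := hj
    rw [vertex_two', hj'] at hjo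
    refine hno _ ?_ hjo
    generalize t'.dir = x at *
    clear * - hd
    revert x; decide
  · exfalso
    have hj' : t'.vertex s 2 = t.apex := hj
    have e : t'.vertex s 1 = t'.vertex s 2 + s * step (t'.dir + 3 + 4) := by
      rw [vertex_two', toComplex_step_add_four]; ring
    rw [e, hj'] at hjo
    refine hno _ ?_ hjo.symm
    generalize t'.dir = x at *
    clear * - hd
    revert x; decide

/-- The tile on the other side of the hypotenuse. -/
lemma exists_neighbor (h : IsCorrectTriTiling s T) (hs : s ≠ 0) {t : TriTile} (ht : t ∈ T) :
    ∃ t' ∈ T, t'.apex = t.apex + s * step (t.dir + 1) ∧ t'.dir = t.dir + 4 := by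
  let m : ℂ := (1 / 2 : ℝ) • (1 + Complex.I)
  obtain ⟨t', ht', hx, ε, hε, hy⟩ := h.exists_segment hs (t.apex + s * step t.dir * m)
    (s * step (t.dir + 1))
  have hout : t.apex + s * step t.dir * m + ε * (s * step (t.dir + 1)) ∉ t.region s := by
    rw [← step_mul_one_add_I t.isStraight_dir, show t.apex + s * step t.dir * m +
      ε * (s * (step t.dir * (1 + Complex.I))) =
      t.apex + s * step t.dir * (m + ε * (1 + Complex.I)) by ring, mem_region _ hs]
    rintro ⟨-, -, hle⟩
    simp [m] at hle
    linarith
  have hne : t ≠ t' := by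
    rintro rfl; exact hout hy
  have hm : t.apex + s * step t.dir * m ∈ convexHull ℝ (t.vertices s ∩ t'.vertices s) := by
    rw [← h.side_to_side ht ht' hne]
    exact ⟨(mem_region t hs).2 (by simp [stdTriangle, m]; norm_num), hx⟩
  -- the midpoint of the hypotenuse is not in the hull of vertices that miss one of its ends
  have hv1 : t.vertex s 1 ∈ t'.vertices s := by
    by_contra hv
    have h2 : t.vertices s ∩ t'.vertices s ⊆
        (fun z => t.apex + s * step t.dir * z) '' {z | z.re = 0} := by
      rintro x ⟨hx, hx'⟩
      rw [vertices_eq] at hx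
      obtain ⟨z, rfl | rfl | rfl, rfl⟩ := hx
      · exact ⟨0, by simp, rfl⟩
      · simp only [mul_one, ← vertex_one] at hx'
        exact absurd hx' hv
      · exact ⟨Complex.I, by simp, rfl⟩
    have h3 := convexHull_mono h2 hm
    rw [convexHull_affine_image, (convex_hyperplane isLinearMap_re 0).convexHull_eq] at h3
    obtain ⟨z, hz, hz'⟩ := h3
    rw [mul_left_cancel₀ (mul_step_ne_zero hs _) (add_left_cancel hz')] at hz
    simp [m] at hz
  have hv2 : t.vertex s 2 ∈ t'.vertices s := by
    by_contra hv
    have h2 : t.vertices s ∩ t'.vertices s ⊆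
        (fun z => t.apex + s * step t.dir * z) '' {z | z.im = 0} := by
      rintro x ⟨hx, hx'⟩
      rw [vertices_eq] at hx
      obtain ⟨z, rfl | rfl | rfl, rfl⟩ := hx
      · exact ⟨0, by simp, rfl⟩
      · exact ⟨1, by simp, rfl⟩
      · simp only [mul_assoc, mul_comm (step t.dir : ℂ), I_mul_step, ← vertex_two] at hx'
        exact absurd hx' hv
    have h3 := convexHull_mono h2 hm
    rw [convexHull_affine_image, (convex_hyperplane isLinearMap_im 0).convexHull_eq] at h3
    obtain ⟨z, hz, hz'⟩ := h3
    rw [mul_left_cancel₀ (mul_step_ne_zero hs _) (add_left_cancel hz')] at hz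
    simp [m] at hz
  obtain ⟨j, hj⟩ := hv1
  obtain ⟨k, hk⟩ := hv2
  have hjk : t'.vertex s k = t'.vertex s j + s * step (t.dir + 3) := by
    rw [hj, hk, vertex_two']
  -- the common side is the hypotenuse of both tiles, as it is diagonal
  have hd := t.isStraight_dir
  have hd' := t'.isStraight_dir
  have hcases : (j = 1 ∧ k = 2 ∧ t.dir + 3 = t'.dir + 3) ∨
      (j = 2 ∧ k = 1 ∧ t.dir + 3 = t'.dir + 3 + 4) := by
    have aux : ∀ (x y : ZMod 8) (j k : Fin 3), IsStraight x → IsStraight y →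
        offset y k = offset y j + step (x + 3) →
        (j = 1 ∧ k = 2 ∧ x + 3 = y + 3) ∨ (j = 2 ∧ k = 1 ∧ x + 3 = y + 3 + 4) := by decide
    refine aux t.dir t'.dir j k hd hd' ?_
    rw [vertex_eq, vertex_eq, add_assoc, add_right_inj, ← mul_add, mul_right_inj' hs,
      ← GaussianInt.toComplex_add, GaussianInt.toComplex_inj] at hjk
    exact hjk
  rcases hcases with ⟨rfl, rfl, hdir⟩ | ⟨rfl, rfl, hdir⟩
  · exfalso
    have hdir' : t.dir = t'.dir := add_right_cancel hdir
    rw [vertex_one, vertex_one, hdir', add_left_inj] at hj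
    apply hout
    rw [region_eq, hdir', ← hj, ← region_eq]
    rwa [hdir', ← hj] at hy
  · have hdir' : t'.dir = t.dir + 4 := by
      generalize t.dir = x at *
      generalize t'.dir = y at *
      clear * - hdir
      revert x y; decide
    refine ⟨t', ht', ?_, hdir'⟩
    rw [vertex_two, vertex_one, hdir', add_right_comm, toComplex_step_add_four] at hj
    rw [← step_add_step_add_two hd]
    linear_combination hj

end IsCorrectTriTiling

/-! ### Tilings by triangles are not periodic -/

lemma isCenter_sub_step_zero {p : GaussianInt} (hp : ¬ IsCenter p) : IsCenter (p - step 0) := by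
  have h := isCenter_add_step p 4
  rw [show step 4 = - step 0 by decide, ← sub_eq_add_neg] at h
  exact h.2 ⟨fun hh => absurd hh hp, fun hh => absurd (by decide) hh⟩

namespace IsCorrectTriTiling

open TriTile

variable {s : ℂ} {T : Set TriTile}

/-- The apexes of the tiles contain all points of even coordinate sum of a lattice. -/
lemma exists_apex (h : IsCorrectTriTiling s T) (hs : s ≠ 0) {t₀ : TriTile} (ht₀ : t₀ ∈ T)
    {p : GaussianInt} (hp : IsCenter p) {δ : ZMod 8} (hδ : IsStraight δ) :
    ∃ t ∈ T, t.apex = t₀.apex + s * p ∧ t.dir = δ := by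
  suffices h0 : ∃ t ∈ T, t.apex = t₀.apex + s * p by
    obtain ⟨t, ht, hp⟩ := h0
    rw [← hp]
    exact h.exists_rotated hs ht hδ
  obtain ⟨q, rfl⟩ := hp.exists_eq_mul
  clear hp
  induction q using GaussianInt.induction_step with
  | zero => exact ⟨t₀, ht₀, by simp⟩
  | step q δ hδ ih =>
    obtain ⟨t, ht, hq⟩ := ih
    obtain ⟨t', ht', h1, h2⟩ := h.exists_rotated hs ht hδ
    obtain ⟨t'', ht'', h3, -⟩ := h.exists_neighbor hs ht'
    refine ⟨t'', ht'', ?_⟩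
    rw [h3, h1, h2, hq, mul_add, oneAddI_mul_step hδ, GaussianInt.toComplex_add]
    ring

/-- The apexes of all tiles are points of this lattice, since the tiles found there cover the
plane. -/
lemma apex_mem_lattice (h : IsCorrectTriTiling s T) (hs : s ≠ 0) {t₀ t : TriTile} (ht₀ : t₀ ∈ T)
    (ht : t ∈ T) : ∃ p, IsCenter p ∧ t.apex = t₀.apex + s * p := by
  obtain ⟨p, hp, hz⟩ := exists_isCenter_near ((t.center s - t₀.apex) / s)
  obtain ⟨δ, hδ, w, hw, e⟩ := exists_step_mul hz
  obtain ⟨t', ht', h1, h2⟩ := h.exists_apex hs ht₀ hp hδ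
  have hc : t.center s = t'.apex + s * step t'.dir * w := by
    rw [h1, h2, mul_assoc, ← e]; field_simp; ring
  have := h.eq_of_center_mem hs ht ht' (by rw [hc, mem_region _ hs]; exact hw)
  subst this
  exact ⟨p, hp, h1⟩

/-- The crossing at an end of a hypotenuse is not of type `C₄`, as there are arrows at an angle
of `45°`. -/
lemma crossing_corner (h : IsCorrectTriTiling s T) (hs : s ≠ 0) {t : TriTile} (ht : t ∈ T) :
    ∃ σ : Crossing, ShowsRays (triArrows s T) s (t.vertex s 1) σ.ray8 := by
  obtain ⟨d, hd | hd⟩ := h.crossings t ht (t.vertex s 1) ⟨1, rfl⟩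
  · exfalso
    obtain ⟨σ, -, hσ⟩ := IsCrossingC4.showsRays (X := triArrows s T) hs (hasStepArrows T) hd
    have h1 : AreJoined (triArrows s T) (t.vertex s 1) (t.vertex s 2) := joined ht 1
    have h2 : AreJoined (triArrows s T) (t.vertex s 0) (t.vertex s 1) := joined ht 0
    rw [vertex_two', hσ.joined_iff] at h1
    have e : t.vertex s 0 = t.vertex s 1 + s * step (t.dir + 4) := by
      rw [vertex_one, vertex_zero, toComplex_step_add_four]; ring
    have h2' := h2.symm
    rw [e, hσ.joined_iff] at h2'
    have h3 := σ.isStraight_sub_axis h1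
    have h4 := σ.isStraight_sub_axis h2'
    rw [show t.dir + 4 - σ.axis = t.dir + 3 - σ.axis + 1 by ring, isStraight_add_one] at h4
    exact h4 h3
  · exact IsCrossingC8.showsRays (X := triArrows s T) hs (hasStepArrows T) hd

lemma _root_.Crossing.not_ray4_out (τ : Crossing) {δ : ZMod 8} {c : TileColor}
    (h : δ - τ.axis = 2 ∨ δ - τ.axis = 6) : τ.ray4 δ ≠ some (true, c) := by
  obtain ⟨k, a, e⟩ := τ
  rcases h with h | h <;> rw [Crossing.ray4_of_sub_eq a e h] <;> clear h <;> revert a e c <;>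
    decide

/-- The color of a tile tells the axis of the crossing at its apex: one of the two legs is
perpendicular to the axis and enters the apex, with the tile on its left or on its right. -/
lemma color_eq_red_iff (h : IsCorrectTriTiling s T) {t : TriTile} (ht : t ∈ T)
    {σ : Crossing} (hax : IsStraight σ.axis) (hσ : ShowsRays (triArrows s T) s t.apex σ.ray4)
    {d : ℂ} (hd : IsCrossingC4 (crossing s T t.apex) t.apex d) {ρ : ℝ} (hρ : 0 < ρ)
    (hdρ : d = ρ * (s * step σ.axis)) :
    t.color = .red ↔ (t.dir - σ.axis = 0 ∨ t.dir - σ.axis = 4) := by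
  have hρ' : (ρ : ℂ) ≠ 0 := by exact_mod_cast hρ.ne'
  have hstr : IsStraight (t.dir - σ.axis) := by
    rw [isStraight_sub]; exact ⟨fun _ => hax, fun _ => t.isStraight_dir⟩
  -- an arrow perpendicular to the axis has a direction `ε` with `I * d` along `± step ε`
  have perp : ∀ ε, (ε - σ.axis = 2 ∨ ε - σ.axis = 6) →
      ∃ r : ℝ, s * (step ε : ℂ) = r * (Complex.I * d) := by
    rintro ε (hε | hε)
    · refine ⟨1 / ρ, ?_⟩
      have e : ε = σ.axis + 2 := by rw [← hε]; ring
      rw [hdρ, e, ← I_mul_step]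
      push_cast; field_simp
    · refine ⟨-(1 / ρ), ?_⟩
      have e : ε = σ.axis + 2 + 4 := by
        rw [add_assoc, show (2 + 4 : ZMod 8) = 6 by decide, ← hε]; ring
      rw [hdρ, e, toComplex_step_add_four, ← I_mul_step]
      push_cast; field_simp
  have mem : ∀ j, t.arrow s j ∈ triArrows s T := fun j => ⟨t, ht, j, rfl⟩
  have hc : t.dir - σ.axis = 0 ∨ t.dir - σ.axis = 4 ∨ t.dir - σ.axis = 2 ∨ t.dir - σ.axis = 6 := by
    generalize t.dir - σ.axis = x at *
    clear * - hstr
    revert x; decide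
  have e0 : t.arrow s 0 = if t.ccw 0 then ⟨t.apex, t.apex + s * step t.dir, t.sideColor 0⟩
      else ⟨t.apex + s * step t.dir, t.apex, t.sideColor 0⟩ := by
    rw [← vertex_one]; rfl
  have e2 : t.arrow s 2 = if t.ccw 2 then ⟨t.apex + s * step (t.dir + 2), t.apex, t.sideColor 2⟩
      else ⟨t.apex, t.apex + s * step (t.dir + 2), t.sideColor 2⟩ := by
    rw [← vertex_two]; rfl
  have red : (t.dir - σ.axis = 0 ∨ t.dir - σ.axis = 4) → t.color = .red := by
    intro hx
    have hx' : t.dir + 2 - σ.axis = 2 ∨ t.dir + 2 - σ.axis = 6 := by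
      rw [add_sub_right_comm]
      rcases hx with hx | hx <;> rw [hx] <;> decide
    have hccw : t.ccw 2 = true := by
      by_contra hn
      have := mem 2
      rw [e2, if_neg hn] at this
      exact σ.not_ray4_out hx' ((hσ _ _).1.1 this)
    rw [if_pos hccw] at e2
    have := h.left_right _ d hd t ht 2 (by rw [e2]) (by
      rw [e2]
      obtain ⟨r, hr⟩ := perp _ hx'
      exact ⟨r, by rw [← hr]; ring⟩)
    rw [this, if_pos hccw]
  have green : (t.dir - σ.axis = 2 ∨ t.dir - σ.axis = 6) → t.color = .green := by
    intro hx
    have hccw : ¬ t.ccw 0 = true := by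
      intro hn
      have := mem 0
      rw [e0, if_pos hn] at this
      exact σ.not_ray4_out hx ((hσ _ _).1.1 this)
    rw [if_neg hccw] at e0
    have := h.left_right _ d hd t ht 0 (by rw [e0]) (by
      rw [e0]
      obtain ⟨r, hr⟩ := perp _ hx
      exact ⟨r, by rw [← hr]; ring⟩)
    rw [this, if_neg hccw]
  refine ⟨fun hred => ?_, red⟩
  by_contra hn
  have := green (by tauto)
  rw [hred] at this
  cases this

lemma _root_.TriTile.translate_vertex (a : ℂ) (t : TriTile) (j : Fin 3) :
    (t.translate a).vertex s j = t.vertex s j + a := by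
  rw [TriTile.vertex_eq, TriTile.vertex_eq, show (t.translate a).apex = t.apex + a from rfl,
    show (t.translate a).dir = t.dir from rfl]
  ring

lemma _root_.TriTile.translate_arrow (a : ℂ) (t : TriTile) (j : Fin 3) :
    (t.translate a).arrow s j =
      ⟨(t.arrow s j).src + a, (t.arrow s j).tgt + a, (t.arrow s j).color⟩ := by
  rw [TriTile.arrow, TriTile.arrow, TriTile.translate_vertex, TriTile.translate_vertex,
    show (t.translate a).ccw = t.ccw from rfl, show (t.translate a).sideColor = t.sideColor from rfl]
  split_ifs <;> rfl

theorem not_periodic (h : IsCorrectTriTiling s T) (hs : s ≠ 0) {a : ℂ} (ha : a ≠ 0)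
    (hT : TriTile.translate a '' T = T) : False := by
  obtain ⟨t₀, ht₀, -⟩ := h.exists_segment hs 0 0
  have mem_translate : ∀ t ∈ T, t.translate a ∈ T := fun t ht => by
    rw [← hT]; exact ⟨t, ht, rfl⟩
  have hσ : ∀ p : GaussianInt, ∃ σ : Crossing,
      (IsCenter p → IsStraight σ.axis ∧ ShowsRays (triArrows s T) s (t₀.apex + s * p) σ.ray4 ∧
        ∃ d, IsCrossingC4 (crossing s T (t₀.apex + s * p)) (t₀.apex + s * p) d ∧
          ∃ ρ : ℝ, 0 < ρ ∧ d = ρ * (s * step σ.axis)) ∧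
      (¬ IsCenter p → ShowsRays (triArrows s T) s (t₀.apex + s * p) σ.ray8) := by
    intro p
    by_cases hp : IsCenter p
    · obtain ⟨t, ht, h1, -⟩ := h.exists_apex hs ht₀ hp (δ := 0) (by decide)
      obtain ⟨σ, hσ⟩ := h.crossing_apex hs ht
      rw [h1] at hσ
      exact ⟨σ, fun _ => hσ, fun hn => absurd hp hn⟩
    · obtain ⟨t, ht, h1, h2⟩ := h.exists_apex hs ht₀ (isCenter_sub_step_zero hp) (δ := 0)
        (by decide)
      obtain ⟨σ, hσ⟩ := h.crossing_corner hs ht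
      rw [vertex_one, h1, h2, add_assoc, ← mul_add, ← GaussianInt.toComplex_add,
        sub_add_cancel] at hσ
      exact ⟨σ, fun hn => absurd hn hp, fun _ => hσ⟩
  choose σ hσ4 hσ8 using hσ
  obtain ⟨p, hp, hpa⟩ := h.apex_mem_lattice hs ht₀ (mem_translate t₀ ht₀)
  have hpa' : a = s * p := add_left_cancel hpa
  refine not_periodic_of_showsRays (X := triArrows s T) (s := s) (o := t₀.apex) (σ := σ) ?_
    (fun p hp => (hσ4 p hp).1) ?_ hp ?_ ?_
  · intro p
    by_cases hp : IsCenter p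
    · rw [show rays σ p = (σ p).ray4 from funext fun _ => rays_of_center hp _]
      exact (hσ4 p hp).2.1
    · rw [show rays σ p = (σ p).ray8 from funext fun _ => rays_of_corner hp _]
      exact hσ8 p hp
  · intro p hp δ hδ
    have hδ1 : IsStraight (δ - 1) := by
      rw [← sub_add_cancel δ 1, isStraight_add_one, not_not] at hδ; exact hδ
    have hp' : IsCenter (p + step δ) := by rw [isCenter_add_step]; tauto
    obtain ⟨t, ht, h1, h2⟩ := h.exists_apex hs ht₀ hp hδ1
    obtain ⟨t', ht', h1', h2'⟩ := h.exists_neighbor hs ht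
    rw [h2, sub_add_cancel] at h1'
    have e' : t'.apex = t₀.apex + s * ((p + step δ : GaussianInt) : ℂ) := by
      rw [h1', h1, GaussianInt.toComplex_add]; ring
    have hv1 : t'.vertex s 1 = t.vertex s 2 := by
      have hd := step_add_step_add_two t.isStraight_dir
      rw [vertex_one, vertex_two, h1', h2', toComplex_step_add_four,
        show δ = t.dir + 1 by rw [h2]; ring]
      linear_combination -s * hd
    have hv2 : t'.vertex s 2 = t.vertex s 1 := by
      have hd := step_add_step_add_two t.isStraight_dir
      rw [vertex_one, vertex_two, h1', h2', add_right_comm t.dir, toComplex_step_add_four,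
        show δ = t.dir + 1 by rw [h2]; ring]
      linear_combination -s * hd
    have hne : t ≠ t' := by
      rintro rfl
      exact absurd h2' (by generalize t.dir = x; revert x; decide)
    have key : ∀ t : TriTile, ({(t.arrow s 1).src, (t.arrow s 1).tgt} : Set ℂ) =
        {t.vertex s 1, t.vertex s 2} := by
      intro t
      unfold arrow
      split_ifs
      · rfl
      · exact Set.pair_comm _ _
    have hcol := h.colors_differ t ht t' ht' hne 1 1 (by
      rw [Arrow.SameSegment, key, key, hv1, hv2, Set.pair_comm])
    obtain ⟨x1, x2, d, hd, ρ, hρ, hdρ⟩ := hσ4 p hp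
    obtain ⟨y1, y2, d', hd', ρ', hρ', hdρ'⟩ := hσ4 _ hp'
    rw [← h1] at x2 hd
    rw [← e'] at y2 hd'
    have c1 := h.color_eq_red_iff ht x1 x2 hd hρ hdρ
    have c2 := h.color_eq_red_iff ht' y1 y2 hd' hρ' hdρ'
    have hcc : (t.color = .red ↔ ¬ t'.color = .red) := by
      generalize t.color = c at *
      generalize t'.color = c' at *
      clear * - hcol
      revert c c'; decide
    rw [c1, c2, h2', h2] at hcc
    generalize (σ p).axis = x at *
    generalize (σ (p + step δ)).axis = y at *
    clear * - hcc hδ x1 y1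
    revert δ x y
    decide
  · rintro rfl
    simp at hpa'
    exact ha hpa'
  · rw [← hpa']
    intro x y c
    constructor
    · rintro ⟨t, ht, j, hj⟩
      rw [← hT] at ht
      obtain ⟨t, ht, rfl⟩ := ht
      rw [translate_arrow] at hj
      obtain ⟨h1, h2, h3⟩ := Arrow.mk.inj hj
      refine ⟨t, ht, j, ?_⟩
      rw [add_right_cancel h1, add_right_cancel h2, h3]
    · rintro ⟨t, ht, j, hj⟩
      refine ⟨t.translate a, mem_translate t ht, j, ?_⟩
      rw [translate_arrow, ← hj]

end IsCorrectTriTiling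

/-! ### Square tiles -/

/-- The standard square, with corners `1`, `i`, `-1` and `-i`. -/
def stdSquare : Set ℂ := {z : ℂ | |z.re| + |z.im| ≤ 1}

lemma ball_subset_stdSquare : Metric.ball 0 (1 / 2) ⊆ stdSquare := by
  intro z hz
  rw [Metric.mem_ball, dist_zero_right] at hz
  have h1 := Complex.abs_re_le_norm z
  have h2 := Complex.abs_im_le_norm z
  change |z.re| + |z.im| ≤ 1
  linarith

lemma stdSquare_subset_closedBall : stdSquare ⊆ Metric.closedBall 0 1 := by
  intro z hz
  rw [Metric.mem_closedBall, dist_zero_right]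
  exact (Complex.norm_le_abs_re_add_abs_im _).trans hz

/-- The set of all sides and slanted arrows of a set of square tiles. -/
def squareArrows (s : ℂ) (T : Set SquareTile) : Set Arrow :=
  {a | ∃ t ∈ T, (∃ j, a = t.sideArrow s j) ∨ a ∈ t.slantedArrows s}

namespace SquareTile

variable {s : ℂ} (t : SquareTile)

/-- The direction of a corner, seen from the center. -/
def dir (j : Fin 4) : ZMod 8 := 2 * ((j : ℕ) : ZMod 8)

lemma isStraight_dir (j : Fin 4) : IsStraight (dir j) := isStraight_two_mul _

lemma dir_add (j k : Fin 4) : dir (j + k) = dir j + dir k := by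
  revert j k; decide

lemma corner_eq (j : Fin 4) : t.corner s j = t.center + s * step (dir j) := by
  rw [corner, I_pow_eq_step]; rfl

lemma corner_add_one (j : Fin 4) :
    t.corner s (j + 1) = t.corner s j + s * step (dir j + 3) := by
  rw [corner_eq, corner_eq, dir_add, show dir 1 = 2 by decide,
    ← step_add_step_add_three (isStraight_dir j)]
  ring

lemma corners_eq (j : Fin 4) : t.corners s =
    (fun z => t.center + s * step (dir j) * z) '' {1, Complex.I, -1, -Complex.I} := by
  have h : ∀ k : Fin 4, t.corner s (j + k) = t.center + s * step (dir j) * step (dir k) := by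
    intro k
    rw [corner_eq, dir_add, ← step_mul_step (isStraight_dir j)]; ring
  have e : ∀ k : Fin 4, (step (dir k) : ℂ) = Complex.I ^ (k : ℕ) := fun k =>
    (I_pow_eq_step _).symm
  ext z
  have hr : z ∈ t.corners s ↔ ∃ k, t.corner s (j + k) = z := by
    rw [corners, Set.mem_range]
    constructor
    · rintro ⟨k, hk⟩
      exact ⟨k - j, by rw [add_sub_cancel, hk]⟩
    · rintro ⟨k, hk⟩
      exact ⟨j + k, hk⟩
  rw [hr]
  simp only [h, e]
  simp [Fin.exists_fin_succ, pow_succ]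

lemma region_eq (j : Fin 4) :
    t.region s = (fun z => t.center + s * step (dir j) * z) '' stdSquare := by
  rw [region, corners_eq t j, convexHull_affine_image, convexHull_square]; rfl

lemma mem_region (hs : s ≠ 0) (j : Fin 4) {z : ℂ} :
    t.center + s * step (dir j) * z ∈ t.region s ↔ z ∈ stdSquare := by
  rw [region_eq t j]
  constructor
  · rintro ⟨w, hw, h⟩
    rwa [← mul_left_cancel₀ (mul_step_ne_zero hs _) (add_left_cancel h)]
  · exact fun h => ⟨z, h, rfl⟩

lemma norm_half_diagonal : ‖s * (step (dir 0) : ℂ)‖ = ‖s‖ := by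
  rw [show step (dir 0) = 1 by decide]; simp

lemma ball_subset_region (hs : s ≠ 0) : Metric.ball t.center (‖s‖ * (1 / 2)) ⊆ t.region s := by
  have := ball_subset_affine_image (c := t.center) (mul_step_ne_zero hs (dir 0))
    ball_subset_stdSquare
  rwa [← region_eq, norm_half_diagonal, mul_zero, add_zero] at this

lemma region_subset_closedBall : t.region s ⊆ Metric.closedBall t.center (‖s‖ * 1) := by
  have := affine_image_subset_closedBall (c := t.center) (u := s * step (dir 0))
    stdSquare_subset_closedBall
  rwa [← region_eq, norm_half_diagonal, mul_zero, add_zero] at this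

lemma isClosed_region : IsClosed (t.region s) :=
  (Set.finite_range _).isClosed_convexHull ℝ

lemma convex_region : Convex ℝ (t.region s) := convex_convexHull ℝ _

lemma corner_mem_region (j : Fin 4) : t.corner s j ∈ t.region s :=
  subset_convexHull ℝ _ ⟨j, rfl⟩

lemma center_mem_region (hs : s ≠ 0) : t.center ∈ t.region s := by
  have := (t.mem_region hs 0 (z := 0)).2 (by simp [stdSquare])
  simpa using this

lemma slantedArrows_eq : t.slantedArrows s =
    {⟨t.center + s * step (dir t.axis + 4), t.center, t.axisColor⟩,
     ⟨t.center, t.center + s * step (dir t.axis), t.axisColor⟩,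
     ⟨t.center + s * step (dir t.axis + 2), t.center, t.leftColor⟩,
     ⟨t.center + s * step (dir t.axis + 6), t.center, t.leftColor.other⟩} := by
  rw [slantedArrows, corner_eq, corner_eq, corner_eq, corner_eq, dir_add, dir_add, dir_add]
  rfl

lemma hasStepArrows (T : Set SquareTile) : HasStepArrows (squareArrows s T) s := by
  rintro _ ⟨t, -, ⟨j, rfl⟩ | ha⟩
  · unfold sideArrow
    split_ifs
    · exact ⟨_, corner_add_one t j⟩
    · refine ⟨dir j + 3 + 4, ?_⟩
      simp only
      rw [corner_add_one, toComplex_step_add_four]; ring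
  · have key : ∀ δ, ∃ ε, t.center = t.center + s * step δ + s * step ε := fun δ =>
      ⟨δ + 4, by rw [toComplex_step_add_four]; ring⟩
    rw [slantedArrows_eq] at ha
    rcases ha with rfl | rfl | rfl | rfl
    · exact key _
    · exact ⟨_, rfl⟩
    · exact key _
    · exact key _

/-- The crossing at the center of a tile. -/
def crossingAtCenter : Crossing := ⟨dir t.axis, t.axisColor, t.leftColor⟩

lemma translate_corner (a : ℂ) (j : Fin 4) : (t.translate a).corner s j = t.corner s j + a := by
  simp only [corner, translate]; ring

lemma translate_sideArrow (a : ℂ) (j : Fin 4) : (t.translate a).sideArrow s j =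
    ⟨(t.sideArrow s j).src + a, (t.sideArrow s j).tgt + a, (t.sideArrow s j).color⟩ := by
  rw [sideArrow, sideArrow, translate_corner, translate_corner,
    show (t.translate a).ccw = t.ccw from rfl, show (t.translate a).sideColor = t.sideColor from rfl]
  split_ifs <;> rfl

lemma mem_slantedArrows_translate (a x y : ℂ) (c : TileColor) :
    ⟨x + a, y + a, c⟩ ∈ (t.translate a).slantedArrows s ↔ ⟨x, y, c⟩ ∈ t.slantedArrows s := by
  simp only [slantedArrows, translate_corner, Set.mem_insert_iff, Set.mem_singleton_iff,
    Arrow.mk.injEq]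
  simp only [translate, add_left_inj]

end SquareTile

/-! ### Tilings by squares are not periodic -/

namespace IsCorrectSquareTiling

open SquareTile

variable {s : ℂ} {T : Set SquareTile}

lemma eq_of_center_mem (h : IsCorrectSquareTiling s T) (hs : s ≠ 0) {t t' : SquareTile}
    (ht : t ∈ T) (ht' : t' ∈ T) (hc : t.center ∈ t'.region s) : t = t' :=
  h.tiling.eq_of_mem convex_region (r := ‖s‖ * (1 / 2)) (by positivity) SquareTile.center
    (fun t => t.ball_subset_region hs) ht ht' hc

lemma exists_segment (h : IsCorrectSquareTiling s T) (hs : s ≠ 0) (x w : ℂ) :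
    ∃ t ∈ T, x ∈ t.region s ∧ ∃ ε : ℝ, 0 < ε ∧ x + ε * w ∈ t.region s :=
  h.tiling.exists_segment (r := ‖s‖ * (1 / 2)) (by positivity) SquareTile.center
    (fun t => t.ball_subset_region hs) (fun t => t.region_subset_closedBall)
    (fun t => t.isClosed_region) x w

/-- The crossing at the center of a square tile consists of the slanted arrows of the tile, since
no other tile reaches the center. -/
lemma showsRays_center (h : IsCorrectSquareTiling s T) (hs : s ≠ 0) {t : SquareTile}
    (ht : t ∈ T) : ShowsRays (squareArrows s T) s t.center t.crossingAtCenter.ray4 := by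
  -- an arrow that enters or leaves the center of `t` is a slanted arrow of `t`
  have key : ∀ a, a ∈ squareArrows s T → (a.src = t.center ∨ a.tgt = t.center) →
      a ∈ t.slantedArrows s := by
    rintro a ⟨t', ht', ha⟩ hc
    have hcor : ∀ j, t.corner s j ≠ t.center := by
      intro j hj
      rw [corner_eq, add_eq_left] at hj
      exact mul_step_ne_zero hs _ hj
    have hmem : a.src ∈ t'.region s ∧ a.tgt ∈ t'.region s := by
      rcases ha with ⟨j, rfl⟩ | ha
      · unfold sideArrow
        split_ifs
        · exact ⟨corner_mem_region _ _, corner_mem_region _ _⟩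
        · exact ⟨corner_mem_region _ _, corner_mem_region _ _⟩
      · rcases ha with rfl | rfl | rfl | rfl <;>
          simp only [corner_mem_region, center_mem_region _ hs, and_self]
    have heq : t = t' := by
      apply h.eq_of_center_mem hs ht ht'
      rcases hc with hc | hc <;> rw [← hc]
      · exact hmem.1
      · exact hmem.2
    subst heq
    rcases ha with ⟨j, rfl⟩ | ha
    · exfalso
      unfold sideArrow at hc
      split_ifs at hc
      · exact hc.elim (hcor _) (hcor _)
      · exact hc.elim (hcor _) (hcor _)
    · exact ha
  have hv : ∀ δ : ZMod 8, ¬ s * (step δ : ℂ) = 0 := mul_step_ne_zero hs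
  have key' : ∀ a, (a.src = t.center ∨ a.tgt = t.center) →
      (a ∈ squareArrows s T ↔ a ∈ t.slantedArrows s) := fun a ha =>
    ⟨fun h => key a h ha, fun h => ⟨t, ht, Or.inr h⟩⟩
  intro δ c'
  rw [key' _ (Or.inl rfl), key' _ (Or.inr rfl), slantedArrows_eq]
  unfold crossingAtCenter
  generalize t.axisColor = c
  generalize t.leftColor = e
  generalize dir t.axis = k
  have hδ : δ = k + (δ - k) := by ring
  generalize δ - k = ε at hδ
  subst hδ
  rw [Crossing.ray4_of_sub_eq c e (k := k) (δ := k + ε) (ε := ε) (by ring)]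
  simp only [Set.mem_insert_iff, Set.mem_singleton_iff, Arrow.mk.injEq, add_right_inj,
    mul_step_inj hs, left_eq_add, add_eq_left, hv, false_and, and_false, or_false, false_or,
    true_and]
  clear hv key key'
  constructor
  · revert ε c' c e; decide
  · revert ε c' c e; decide

/-- The tile on the other side of side `j`. -/
lemma exists_neighbor (h : IsCorrectSquareTiling s T) (hs : s ≠ 0) {t : SquareTile} (ht : t ∈ T)
    (j : Fin 4) : ∃ t' ∈ T, t'.center = t.center + s * step (dir j + 1) := by
  let m : ℂ := (1 / 2 : ℝ) • (1 + Complex.I)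
  obtain ⟨t', ht', hx, ε, hε, hy⟩ := h.exists_segment hs (t.center + s * step (dir j) * m)
    (s * step (dir j + 1))
  have hout : t.center + s * step (dir j) * m + ε * (s * step (dir j + 1)) ∉ t.region s := by
    rw [← step_mul_one_add_I (isStraight_dir j), show t.center + s * step (dir j) * m +
      ε * (s * (step (dir j) * (1 + Complex.I))) =
      t.center + s * step (dir j) * (m + ε * (1 + Complex.I)) by ring, mem_region _ hs]
    intro hle
    change |_| + |_| ≤ (1 : ℝ) at hle
    have hle' := (add_le_add (le_abs_self _) (le_abs_self _)).trans hle
    simp [m] at hle'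
    linarith
  have hne : t ≠ t' := by
    rintro rfl; exact hout hy
  have hm : t.center + s * step (dir j) * m ∈ convexHull ℝ (t.corners s ∩ t'.corners s) := by
    rw [← h.side_to_side ht ht' hne]
    refine ⟨(mem_region t hs j).2 ?_, hx⟩
    simp [stdSquare, m, abs_of_pos]; norm_num
  have e1 : t.corner s j = t.center + s * step (dir j) * 1 := by rw [corner_eq, mul_one]
  have e2 : t.corner s (j + 1) = t.center + s * step (dir j) * Complex.I := by
    rw [corner_eq, dir_add, show dir 1 = 2 by decide, ← I_mul_step]; ring
  -- the midpoint of the side is not in the hull of corners that miss one of its ends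
  have hv1 : t.corner s j ∈ t'.corners s := by
    by_contra hv
    have h2 : t.corners s ∩ t'.corners s ⊆
        (fun z => t.center + s * step (dir j) * z) '' {z | z.re ≤ 0} := by
      rintro x ⟨hx, hx'⟩
      rw [corners_eq t j] at hx
      obtain ⟨z, rfl | rfl | rfl | rfl, rfl⟩ := hx
      · rw [e1] at hv
        exact absurd hx' hv
      · exact ⟨_, by simp, rfl⟩
      · exact ⟨_, by simp, rfl⟩
      · exact ⟨_, by simp, rfl⟩
    have h3 := convexHull_mono h2 hm
    rw [convexHull_affine_image, (convex_halfSpace_le isLinearMap_re 0).convexHull_eq] at h3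
    obtain ⟨z, hz, hz'⟩ := h3
    rw [mul_left_cancel₀ (mul_step_ne_zero hs _) (add_left_cancel hz')] at hz
    simp [m] at hz
    linarith
  have hv2 : t.corner s (j + 1) ∈ t'.corners s := by
    by_contra hv
    have h2 : t.corners s ∩ t'.corners s ⊆
        (fun z => t.center + s * step (dir j) * z) '' {z | z.im ≤ 0} := by
      rintro x ⟨hx, hx'⟩
      rw [corners_eq t j] at hx
      obtain ⟨z, rfl | rfl | rfl | rfl, rfl⟩ := hx
      · exact ⟨_, by simp, rfl⟩
      · rw [e2] at hv
        exact absurd hx' hv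
      · exact ⟨_, by simp, rfl⟩
      · exact ⟨_, by simp, rfl⟩
    have h3 := convexHull_mono h2 hm
    rw [convexHull_affine_image, (convex_halfSpace_le isLinearMap_im 0).convexHull_eq] at h3
    obtain ⟨z, hz, hz'⟩ := h3
    rw [mul_left_cancel₀ (mul_step_ne_zero hs _) (add_left_cancel hz')] at hz
    simp [m] at hz
    linarith
  obtain ⟨k, hk⟩ := hv1
  obtain ⟨l, hl⟩ := hv2
  have hkl : t'.corner s l = t'.corner s k + s * step (dir j + 3) := by
    rw [hk, hl, corner_add_one]
  -- a side with this direction and orientation is side `j` or the opposite one, reversed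
  have hcases : k = j ∨ dir k = dir j + 6 := by
    have aux : ∀ j k l : Fin 4, step (dir l) = step (dir k) + step (dir j + 3) →
        k = j ∨ dir k = dir j + 6 := by decide
    refine aux j k l ?_
    rw [corner_eq, corner_eq, add_assoc, add_right_inj, ← mul_add, mul_right_inj' hs,
      ← GaussianInt.toComplex_add, GaussianInt.toComplex_inj] at hkl
    exact hkl
  rcases hcases with rfl | hk'
  · exfalso
    rw [corner_eq, corner_eq, add_left_inj] at hk
    apply hout
    rw [region_eq t k, ← hk, ← region_eq]
    rwa [← hk] at hy
  · refine ⟨t', ht', ?_⟩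
    rw [corner_eq, corner_eq, hk', show (6 : ZMod 8) = 2 + 4 by decide, ← add_assoc,
      toComplex_step_add_four] at hk
    rw [← step_add_step_add_two (isStraight_dir j)]
    linear_combination hk

lemma _root_.SquareTile.exists_dir {δ : ZMod 8} (h : IsStraight δ) : ∃ j, dir j = δ := by
  revert δ; decide

/-- The centers of the tiles are all points of even coordinate sum of a lattice. -/
lemma exists_center (h : IsCorrectSquareTiling s T) (hs : s ≠ 0) {t₀ : SquareTile} (ht₀ : t₀ ∈ T)
    {p : GaussianInt} (hp : IsCenter p) : ∃ t ∈ T, t.center = t₀.center + s * p := by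
  obtain ⟨q, rfl⟩ := hp.exists_eq_mul
  clear hp
  induction q using GaussianInt.induction_step with
  | zero => exact ⟨t₀, ht₀, by simp⟩
  | step q δ hδ ih =>
    obtain ⟨t, ht, hq⟩ := ih
    obtain ⟨j, rfl⟩ := exists_dir hδ
    obtain ⟨t', ht', h1⟩ := h.exists_neighbor hs ht j
    refine ⟨t', ht', ?_⟩
    rw [h1, hq, mul_add, oneAddI_mul_step hδ, GaussianInt.toComplex_add]
    ring

lemma center_mem_lattice (h : IsCorrectSquareTiling s T) (hs : s ≠ 0) {t₀ t : SquareTile}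
    (ht₀ : t₀ ∈ T) (ht : t ∈ T) : ∃ p, IsCenter p ∧ t.center = t₀.center + s * p := by
  obtain ⟨p, hp, hz⟩ := exists_isCenter_near ((t.center - t₀.center) / s)
  obtain ⟨t', ht', h1⟩ := h.exists_center hs ht₀ hp
  have hc : t.center = t'.center + s * step (dir 0) * ((t.center - t₀.center) / s - p) := by
    rw [h1, show step (dir 0) = 1 by decide, GaussianInt.toComplex_one]; field_simp; ring
  have := h.eq_of_center_mem hs ht ht' (by rw [hc, mem_region _ hs]; exact hz)
  subst this
  exact ⟨p, hp, h1⟩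

theorem not_periodic (h : IsCorrectSquareTiling s T) (hs : s ≠ 0) {a : ℂ} (ha : a ≠ 0)
    (hT : SquareTile.translate a '' T = T) : False := by
  obtain ⟨t₀, ht₀, -⟩ := h.exists_segment hs 0 0
  have mem_translate : ∀ t ∈ T, t.translate a ∈ T := fun t ht => by
    rw [← hT]; exact ⟨t, ht, rfl⟩
  have hσ : ∀ p : GaussianInt, ∃ σ : Crossing,
      (IsCenter p → ∃ t ∈ T, t.center = t₀.center + s * p ∧ σ = t.crossingAtCenter) ∧
      (¬ IsCenter p → ShowsRays (squareArrows s T) s (t₀.center + s * p) σ.ray8) := by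
    intro p
    by_cases hp : IsCenter p
    · obtain ⟨t, ht, h1⟩ := h.exists_center hs ht₀ hp
      exact ⟨_, fun _ => ⟨t, ht, h1, rfl⟩, fun hn => absurd hp hn⟩
    · obtain ⟨t, ht, h1⟩ := h.exists_center hs ht₀ (isCenter_sub_step_zero hp)
      obtain ⟨d, hd⟩ := h.crossings t ht (t.corner s 0) ⟨0, rfl⟩
      obtain ⟨σ, hσ⟩ := IsCrossingC8.showsRays (X := squareArrows s T) hs (hasStepArrows T) hd
      rw [corner_eq, h1, add_assoc, ← mul_add, show dir 0 = 0 by decide,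
        ← GaussianInt.toComplex_add, sub_add_cancel] at hσ
      exact ⟨σ, fun hn => absurd hn hp, fun _ => hσ⟩
  choose σ hσ4 hσ8 using hσ
  obtain ⟨p, hp, hpa⟩ := h.center_mem_lattice hs ht₀ (mem_translate t₀ ht₀)
  have hpa' : a = s * p := add_left_cancel hpa
  refine not_periodic_of_showsRays (X := squareArrows s T) (s := s) (o := t₀.center) (σ := σ) ?_
    ?_ ?_ hp ?_ ?_
  · intro p
    by_cases hp : IsCenter p
    · rw [show rays σ p = (σ p).ray4 from funext fun _ => rays_of_center hp _]
      obtain ⟨t, ht, h1, h2⟩ := hσ4 p hp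
      rw [h2, ← h1]
      exact h.showsRays_center hs ht
    · rw [show rays σ p = (σ p).ray8 from funext fun _ => rays_of_corner hp _]
      exact hσ8 p hp
  · intro p hp
    obtain ⟨t, ht, h1, h2⟩ := hσ4 p hp
    rw [h2]
    exact isStraight_dir _
  · intro p hp δ hδ
    have hδ1 : IsStraight (δ - 1) := by
      rw [← sub_add_cancel δ 1, isStraight_add_one, not_not] at hδ; exact hδ
    have hp' : IsCenter (p + step δ) := by rw [isCenter_add_step]; tauto
    obtain ⟨j, hj⟩ := exists_dir hδ1
    have hδj : δ = dir j + 1 := by rw [hj]; ring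
    obtain ⟨t, ht, h1, h2⟩ := hσ4 p hp
    obtain ⟨t', ht', h1', h2'⟩ := hσ4 _ hp'
    have hc : t'.center = t.center + (s * step (dir j) + s * step (dir j + 2)) := by
      rw [h1', h1, GaussianInt.toComplex_add, hδj, ← step_add_step_add_two (isStraight_dir j)]
      ring
    have hv1 : t'.corner s (j + 2) = t.corner s (j + 1) := by
      rw [corner_eq, corner_eq, hc, dir_add, dir_add, show dir 2 = 4 by decide,
        show dir 1 = 2 by decide, toComplex_step_add_four]
      ring
    have hv2 : t'.corner s (j + 2 + 1) = t.corner s j := by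
      rw [corner_eq, corner_eq, hc, dir_add, dir_add, show dir 2 = 4 by decide,
        show dir 1 = 2 by decide, add_right_comm (dir j), toComplex_step_add_four]
      ring
    have hne : t ≠ t' := by
      rintro rfl
      have hs1 := toComplex_step_ne_zero (dir j + 1)
      rw [← step_add_step_add_two (isStraight_dir j)] at hs1
      rw [left_eq_add, ← mul_add] at hc
      exact mul_ne_zero hs hs1 hc
    have key : ∀ (t : SquareTile) j, ({(t.sideArrow s j).src, (t.sideArrow s j).tgt} : Set ℂ) =
        {t.corner s j, t.corner s (j + 1)} := by
      intro t j
      unfold sideArrow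
      split_ifs
      · rfl
      · exact Set.pair_comm _ _
    have hcol := h.colors_differ t ht t' ht' hne j (j + 2) (by
      rw [Arrow.SameSegment, key, key, hv1, hv2, Set.pair_comm])
    rw [h2, h2']
    unfold triColor at hcol
    simp only [crossingAtCenter]
    generalize t.axis = x at *
    generalize t'.axis = y at *
    clear * - hcol
    revert x y j
    decide
  · rintro rfl
    simp at hpa'
    exact ha hpa'
  · rw [← hpa']
    intro x y c
    constructor
    · rintro ⟨t, ht, hj⟩
      rw [← hT] at ht
      obtain ⟨t, ht, rfl⟩ := ht
      refine ⟨t, ht, ?_⟩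
      rcases hj with ⟨j, hj⟩ | hj
      · rw [translate_sideArrow] at hj
        obtain ⟨h1, h2, h3⟩ := Arrow.mk.inj hj
        exact Or.inl ⟨j, by rw [add_right_cancel h1, add_right_cancel h2, h3]⟩
      · exact Or.inr ((mem_slantedArrows_translate _ _ _ _ _).1 hj)
    · rintro ⟨t, ht, hj⟩
      refine ⟨t.translate a, mem_translate t ht, ?_⟩
      rcases hj with ⟨j, hj⟩ | hj
      · exact Or.inl ⟨j, by rw [translate_sideArrow, ← hj]⟩
      · exact Or.inr ((mem_slantedArrows_translate _ _ _ _ _).2 hj)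

end IsCorrectSquareTiling

theorem theorem3 :
    (∀ s : ℂ, s ≠ 0 → ∀ T : Set TriTile, IsCorrectTriTiling s T →
      ∀ a : ℂ, a ≠ 0 → TriTile.translate a '' T ≠ T) ∧
    (∀ s : ℂ, s ≠ 0 → ∀ T : Set SquareTile, IsCorrectSquareTiling s T →
      ∀ a : ℂ, a ≠ 0 → SquareTile.translate a '' T ≠ T) := by
  exact ⟨fun _ hs _ hT _ ha h => hT.not_periodic hs ha h,
    fun _ hs _ hT _ ha h => hT.not_periodic hs ha h⟩
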